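/- Let $d\in\{1,2\}$, $\mathcal O=(0,1)^d$, $L^p=L^p(\mathcal O;\mathbb R)$, and let $\Lambda$ be the Laplacian on $\mathcal O$ with homogeneous Dirichlet boundary condition. Let $(e_k)_{k\ge1}$ be an orthonormal basis of $L^2$ with $-\Lambda e_k=\lambda_k e_k$, $\lambda_1\le\lambda_2\le\cdots$, and put $\|w\|_{\dot{\mathbb H}^1}^2=\sum_k\lambda_k\langle w,e_k\rangle_{L^2}^2$, $\dot{\mathbb H}^1=\{w\in L^2:\|w\|_{\dot{\mathbb H}^1}<\infty\}$, $\mathbb H^1=\dot{\mathbb H}^1\times L^2$. Let $U_N=\operatorname{span}\{e_1,\dots,e_N\}$, $P_N g=\sum_{k\le N}\langle g,e_k\rangle e_k$ and $\Lambda_N w=-\sum_{k\le N}\lambda_k\langle w,e_k\rangle e_k$. Let $f(z)=c_3z^3+c_2z^2+c_1z+c_0$ with real coefficients and $c_3>0$, and $\Phi(z)=\int_0^z f(y)\,dy$. Let $T>0$, let $X_0=(u_0,v_0)\in\mathbb H^1$ be deterministic, and let $\mathbf Q$ be a symmetric positive operator on $L^2$ with Hilbert--Schmidt square root $\mathbf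 Q^{1/2}$. Let $W(t)=\sum_k\beta_k(t)\mathbf Q^{1/2}b_k$ be a $\mathbf Q$-Wiener process on some probability space, where $(b_k)$ is an orthonormal basis of $L^2$ and the $\beta_k$ are mutually independent standard real Brownian motions. For $N,M\in\mathbb N^+$, $h=T/M$ and $t_m=mh$, consider the full discretization $u_0^N=P_Nu_0$, $v_0^N=P_Nv_0$ and, for $0\le m<M$, $$u^N_{m+1}=u^N_m+\tfrac h2(\bar v^N_{m+1}+v^N_m),$$ $$\bar v^N_{m+1}=v^N_m+\tfrac h2\Lambda_N(u^N_{m+1}+u^N_m)-hP_N\Big(\int_0^1 f\big(u^N_m+\theta(u^N_{m+1}-u^N_m)\big)d\theta\Big),$$ $$v^N_{m+1}=\bar v^N_{m+1}+P_N\big(W(t_{m+1})-W(t_m)\big).$$ Call $h_0$ admissible if for all $N\in\mathbb N^+$, all $h\in(0,h_0]$ and all $u^N_m,v^N_m\in U_N$ the first two equations have exactly one solution $(u^N_{m+1},\bar v^N_{m+1})$. Then: (i) There is an admissible $h_0>0$. (ii) For every $c>0$ there is a constant $C=C(X_0,\mathbf Q,T,c)>0$ (which may also depend on $d$, $f$ and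 the basis $(e_k)$, but not on $N$, $M$, $h$, $m$, $h_0$ or the probability space) such that, for every admissible $h_0$, all $N,M\in\mathbb N^+$ with $h=T/M\le h_0$, and all $m\in\{0,\dots,M\}$, $$\mathbb E\Big[\exp\Big(ch\sum_{i=0}^m\|u^N_i\|_{L^6}^2\Big)\Big]\le C .$$ (iii) Let $C_1\in\mathbb R$ be such that $\Phi+C_1\ge0$ on $\mathbb R$, and let $V_1(u,v)=\tfrac12\|u\|_{\dot{\mathbb H}^1}^2+\tfrac12\|v\|_{L^2}^2+\int_{\mathcal O}\Phi(u(x))\,dx+C_1$. For every $\alpha\ge\operatorname{trace}(\mathbf Q)$ and all $h_0$, $N$, $M$, $h$, $m$ as in (ii), $$\mathbb E\Big[\exp\big(V_1(u^N_m,v^N_m)e^{-\alpha t_m}\big)\Big]\le\exp\Big(V_1(u^N_0,v^N_0)+\tfrac12\operatorname{trace}(\mathbf Q)\int_0^{t_m}e^{-\alpha s}ds\Big).$$ -/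

import Mathlib

open MeasureTheory ProbabilityTheory Filter Topology
open scoped NNReal ENNReal

noncomputable section

namespace StochWave

/-- The open unit cube `(0,1)^d`. -/
def cube (d : ℕ) : TopologicalSpace.Opens (EuclideanSpace ℝ (Fin d)) where
  carrier := {x | ∀ i, x i ∈ Set.Ioo (0 : ℝ) 1}
  is_open' := by
    have h : {x : EuclideanSpace ℝ (Fin d) | ∀ i, x i ∈ Set.Ioo (0 : ℝ) 1}
        = ⋂ i, (fun x : EuclideanSpace ℝ (Fin d) => x i) ⁻¹' Set.Ioo (0 : ℝ) 1 := by
      ext x; simp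
    rw [h]
    exact isOpen_iInter_of_finite fun i => isOpen_Ioo.preimage (by fun_prop)

/-- Lebesgue measure on the cube. -/
abbrev cubeMeasure (d : ℕ) : Measure (EuclideanSpace ℝ (Fin d)) :=
  volume.restrict (cube d : Set (EuclideanSpace ℝ (Fin d)))

/-- The real Hilbert space `L²((0,1)^d)`. -/
abbrev L2 (d : ℕ) : Type := Lp ℝ 2 (cubeMeasure d)

/-- Smooth real functions with compact support in the cube. -/
abbrev CubeTest (d : ℕ) : Type := TestFunction (cube d) ℝ (⊤ : ℕ∞)

/-- The `i`-th classical partial derivative. -/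
def partialDeriv {d : ℕ} (φ : EuclideanSpace ℝ (Fin d) → ℝ) (i : Fin d)
    (x : EuclideanSpace ℝ (Fin d)) : ℝ :=
  fderiv ℝ φ x (EuclideanSpace.single i 1)

/-- `w` lies in `H¹₀` of the cube (the `H¹`-closure of the test functions) and has weak
gradient `g`. -/
def HasH10Gradient {d : ℕ} (w : L2 d) (g : Fin d → L2 d) : Prop :=
  ∃ φ : ℕ → CubeTest d,
    Tendsto (fun n => eLpNorm (fun x => φ n x - w x) 2 (cubeMeasure d)) atTop (𝓝 0) ∧
    ∀ i, Tendsto (fun n => eLpNorm (fun x => partialDeriv (φ n) i x - g i x) 2 (cubeMeasure d))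
      atTop (𝓝 0)

/-- `-Λ w = μ w`, where `Λ` is the Laplacian with homogeneous Dirichlet boundary condition. -/
def IsDirichletEigen {d : ℕ} (μ : ℝ) (w : L2 d) : Prop :=
  ∃ g : Fin d → L2 d, HasH10Gradient w g ∧
    ∀ φ : CubeTest d,
      ∑ i, ∫ x, g i x * partialDeriv φ i x ∂(cubeMeasure d)
        = μ * ∫ x, w x * φ x ∂(cubeMeasure d)

/-- `e 0, e 1, …` is an orthonormal basis of `L²` of eigenfunctions of `-Λ`, with the
eigenvalues `lam 0 ≤ lam 1 ≤ …`. -/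
structure IsDirichletEigenbasis {d : ℕ} (e : HilbertBasis ℕ ℝ (L2 d)) (lam : ℕ → ℝ) : Prop where
  mono : Monotone lam
  eigen : ∀ k, IsDirichletEigen (lam k) (e k)

/-- Membership in `Ḣ¹ = D((-Λ)^{1/2})`. -/
def MemHdotOne {d : ℕ} (e : HilbertBasis ℕ ℝ (L2 d)) (lam : ℕ → ℝ) (w : L2 d) : Prop :=
  Summable fun k => lam k * (inner ℝ w (e k)) ^ 2

/-- The squared norm of `Ḣ¹`. -/
def hdotOneNormSq {d : ℕ} (e : HilbertBasis ℕ ℝ (L2 d)) (lam : ℕ → ℝ) (w : L2 d) : ℝ :=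
  ∑' k, lam k * (inner ℝ w (e k)) ^ 2

/-- The trace of an operator on `L²`, computed in the orthonormal basis `e`. -/
def opTrace {d : ℕ} (e : HilbertBasis ℕ ℝ (L2 d)) (Q : L2 d →L[ℝ] L2 d) : ℝ :=
  ∑' k, inner ℝ (Q (e k)) (e k)

/-- The space `U_N` spanned by the first `N` eigenfunctions. -/
def galerkinSpace {d : ℕ} (e : HilbertBasis ℕ ℝ (L2 d)) (N : ℕ) : Submodule ℝ (L2 d) :=
  Submodule.span ℝ ((fun k => e k) '' {k | k < N})

/-- The projection `P_N g = ∑_{k < N} ⟨g, e_k⟩ e_k`, with `⟨g, e_k⟩ = ∫ g e_k`. -/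
def galerkinProj {d : ℕ} (e : HilbertBasis ℕ ℝ (L2 d)) (N : ℕ)
    (g : EuclideanSpace ℝ (Fin d) → ℝ) : L2 d :=
  ∑ k ∈ Finset.range N, (∫ x, g x * e k x ∂(cubeMeasure d)) • e k

/-- The discrete Laplacian `Λ_N w = -∑_{k < N} λ_k ⟨w, e_k⟩ e_k`. -/
def galerkinLaplacian {d : ℕ} (e : HilbertBasis ℕ ℝ (L2 d)) (lam : ℕ → ℝ) (N : ℕ)
    (w : L2 d) : L2 d :=
  -∑ k ∈ Finset.range N, (lam k * inner ℝ w (e k)) • e k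

/-- The nonlinearity `f(z) = c₃ z³ + c₂ z² + c₁ z + c₀`. -/
def cubic (c₀ c₁ c₂ c₃ : ℝ) (z : ℝ) : ℝ := c₃ * z ^ 3 + c₂ * z ^ 2 + c₁ * z + c₀

/-- The primitive of the nonlinearity `f` that vanishes at `0`. -/
def primitive (f : ℝ → ℝ) (z : ℝ) : ℝ := ∫ y in (0 : ℝ)..z, f y

/-- The energy `V₁(u,v) = ½‖u‖²_{Ḣ¹} + ½‖v‖²_{L²} + F(u) + C₁`, with `F(u)` the integral over the
cube of the primitive of `f` at `u`. -/
def energy {d : ℕ} (e : HilbertBasis ℕ ℝ (L2 d)) (lam : ℕ → ℝ) (f : ℝ → ℝ) (C₁ : ℝ)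
    (u v : L2 d) : ℝ :=
  1 / 2 * hdotOneNormSq e lam u + 1 / 2 * ‖v‖ ^ 2
    + (∫ x, primitive f (u x) ∂(cubeMeasure d)) + C₁

/-- One deterministic step of the averaged vector field method, from `(u, v)` to `(u', v')`
with step size `h`. -/
structure AVFStep {d : ℕ} (e : HilbertBasis ℕ ℝ (L2 d)) (lam : ℕ → ℝ) (f : ℝ → ℝ)
    (N : ℕ) (h : ℝ) (u v u' v' : L2 d) : Prop where
  position : u' = u + h • ((1 / 2 : ℝ) • (v' + v))
  velocity : v' = v + h • galerkinLaplacian e lam N ((1 / 2 : ℝ) • (u' + u))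
    - h • galerkinProj e N (fun x => ∫ θ in (0 : ℝ)..1, f (u x + θ * (u' x - u x)))

/-- For step sizes up to `h₀`, the implicit step is uniquely solvable in every `U_N`. -/
def StepSizeAdmissible {d : ℕ} (e : HilbertBasis ℕ ℝ (L2 d)) (lam : ℕ → ℝ) (f : ℝ → ℝ)
    (h₀ : ℝ) : Prop :=
  ∀ N : ℕ, 1 ≤ N → ∀ h : ℝ, 0 < h → h ≤ h₀ →
    ∀ u ∈ galerkinSpace e N, ∀ v ∈ galerkinSpace e N,
      ∃! p : L2 d × L2 d, AVFStep e lam f N h u v p.1 p.2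

/-- `W` is a Wiener process in `L²` with covariance operator `S ∘ S`:
`W(t) = ∑ₖ βₖ(t) S bₖ` almost surely for each `t`, for an orthonormal basis `b` and mutually
independent Brownian motions `βₖ`. -/
def IsWienerProcess {d : ℕ} (S : L2 d →L[ℝ] L2 d) {Ω : Type*} [MeasurableSpace Ω]
    (P : Measure Ω) (W : ℝ≥0 → Ω → L2 d) : Prop :=
  ∃ (b : HilbertBasis ℕ ℝ (L2 d)) (β : ℕ → ℝ≥0 → Ω → ℝ),
    (∀ k, IsBrownianReal (β k) P) ∧
    iIndepFun (fun k ω (t : ℝ≥0) => β k t ω) P ∧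
    ∀ t, ∀ᵐ ω ∂P, Tendsto (fun n => ∑ k ∈ Finset.range n, β k t ω • S (b k)) atTop (𝓝 (W t ω))

/-- The grid point `t_m = m h`. -/
def gridTime (h : ℝ) (m : ℕ) : ℝ≥0 := (m * h).toNNReal

/-- `(u_m, v_m)`, `0 ≤ m ≤ M`, is a solution of the full discretization (spectral Galerkin in
space, splitting averaged vector field method in time) with `M` steps of size `h`, where `vbar`
holds the intermediate velocities. -/
structure IsFullDiscretization {d : ℕ} (e : HilbertBasis ℕ ℝ (L2 d)) (lam : ℕ → ℝ) (f : ℝ → ℝ)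
    (u₀ v₀ : L2 d) {Ω : Type*} [MeasurableSpace Ω] (P : Measure Ω) (W : ℝ≥0 → Ω → L2 d)
    (N M : ℕ) (h : ℝ) (u v vbar : ℕ → Ω → L2 d) : Prop where
  init_u : ∀ᵐ ω ∂P, u 0 ω = galerkinProj e N u₀
  init_v : ∀ᵐ ω ∂P, v 0 ω = galerkinProj e N v₀
  step : ∀ m < M, ∀ᵐ ω ∂P, AVFStep e lam f N h (u m ω) (v m ω) (u (m + 1) ω) (vbar (m + 1) ω)
  noise : ∀ m < M, ∀ᵐ ω ∂P, v (m + 1) ω =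
    vbar (m + 1) ω + galerkinProj e N (W (gridTime h (m + 1)) ω - W (gridTime h m) ω : L2 d)

/-- The `L⁶` norm on the cube. -/
def normL6 {d : ℕ} (w : L2 d) : ℝ := (eLpNorm w 6 (cubeMeasure d)).toReal

end StochWave

end

/-!
The averaged vector field step is a discrete gradient method: `f` averaged along the segment from
`u` to `u'`, tested against `u' - u`, gives `∫ Φ(u') - ∫ Φ(u)`, so the deterministic step conserves
the Galerkin energy exactly. The energy therefore changes only through the Gaussian increment
added to `v`. For `a * h * trace Q < 1` the moment of `exp (a / 2 * ‖v + ΔW‖ ^ 2)` is at most what a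
single real Gaussian of variance `h * trace Q` gives,
`(1 - a * h * trace Q) ^ (-1/2) * exp (a / (1 - a * h * trace Q) / 2 * ‖v‖ ^ 2)`,
and the discount `exp (-α * t)` with `trace Q ≤ α` decays fast enough to absorb the growth factor
`1 / (1 - a * h * trace Q)`. Iterating over the steps bounds `E exp (V₁ * exp (-α * t))`.

For the `L⁶` norm, the embedding `W^{1,1} ⊆ L²` in dimension at most two, applied to `φ ^ 2` and
`φ ^ 3`, gives `‖u‖_{L⁶} ^ 6 ≤ C * ‖u‖ ^ 2 * ‖∇u‖ ^ 4`. Because `Φ` grows faster than quadratically,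
`‖u‖_{L⁶} ^ 2 ≤ ε * V₁ + D` for every `ε > 0`, and Jensen's inequality over the time grid turns the
bound on each `E exp (ε * V₁)` into one for the sum.

Eliminating the velocity, the implicit step asks for a critical point of a coercive function,
strongly convex as soon as `h ^ 2` times a lower curvature bound of the potential is small enough;
hence it has exactly one solution, for step sizes independent of `N`.
-/

namespace StochWave

open Real

section SquareMGF

variable {Ω : Type*} [MeasurableSpace Ω] {P : Measure Ω}

lemma lintegral_comp_le_of_indepFun [IsFiniteMeasure P] {α β : Type*} [MeasurableSpace α]
    [MeasurableSpace β] {A : Ω → α} {B : Ω → β} (hAB : IndepFun A B P) (hA : AEMeasurable A P)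
    (hB : AEMeasurable B P) {F : α → β → ℝ≥0∞} (hF : Measurable (Function.uncurry F))
    {G : α → ℝ≥0∞} (hFG : ∀ x, ∫⁻ ω, F x (B ω) ∂P ≤ G x) :
    ∫⁻ ω, F (A ω) (B ω) ∂P ≤ ∫⁻ ω, G (A ω) ∂P := by
  have hlaw := (indepFun_iff_map_prod_eq_prod_map_map hA hB).1 hAB
  calc ∫⁻ ω, F (A ω) (B ω) ∂P
      = ∫⁻ z, Function.uncurry F z ∂(P.map fun ω => (A ω, B ω)) :=
        (lintegral_map' hF.aemeasurable (hA.prodMk hB)).symm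
    _ = ∫⁻ x, ∫⁻ y, F x y ∂(P.map B) ∂(P.map A) := by
        rw [hlaw, lintegral_prod _ hF.aemeasurable]; rfl
    _ = ∫⁻ ω, ∫⁻ y, F (A ω) y ∂(P.map B) ∂P :=
        lintegral_map' hF.lintegral_prod_right'.aemeasurable hA
    _ ≤ ∫⁻ ω, G (A ω) ∂P := lintegral_mono fun ω => by
        have hFA : Measurable (F (A ω)) := hF.comp measurable_prodMk_left
        rw [lintegral_map' hFA.aemeasurable hB]
        exact hFG (A ω)

/- Completing the square: the weight `exp (p x² + r x)` with `2 p h = 1 - γ` turns the density of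
`N(0, h)` into a multiple of the density of `N(r h / γ, h / γ)`. -/
lemma gaussianPDFReal_mul_exp_quadratic {h γ : ℝ≥0} (hh : h ≠ 0) (hγ : γ ≠ 0) {p : ℝ}
    (hp : 2 * p * h = 1 - γ) (r x : ℝ) :
    gaussianPDFReal 0 h x * exp (p * x ^ 2 + r * x) =
      (√γ)⁻¹ * exp (r ^ 2 * h / (2 * γ)) * gaussianPDFReal (r * (h / γ)) (h / γ) x := by
  have : (0 : ℝ) < h := by positivity
  have : (0 : ℝ) < γ := by positivity
  have hsqrt : √(2 * π * (h / γ : ℝ≥0)) = √(2 * π * h) * (√γ)⁻¹ := by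
    rw [← Real.sqrt_inv, ← Real.sqrt_mul (by positivity), NNReal.coe_div]
    ring_nf
  have hexp : -(x - 0) ^ 2 / (2 * (h : ℝ)) + (p * x ^ 2 + r * x) =
      r ^ 2 * h / (2 * γ) + -(x - r * (h / γ)) ^ 2 / (2 * (h / γ)) := by
    obtain rfl : p = (1 - γ) / (2 * h) := by field_simp; linarith
    field_simp
    ring
  rw [gaussianPDFReal, gaussianPDFReal, hsqrt, mul_assoc, ← exp_add, NNReal.coe_div, hexp, exp_add]
  field_simp

lemma lintegral_exp_quadratic_gaussianReal {h γ : ℝ≥0} (hh : h ≠ 0) (hγ : γ ≠ 0) {p : ℝ}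
    (hp : 2 * p * h = 1 - γ) (r : ℝ) :
    ∫⁻ x, ENNReal.ofReal (exp (p * x ^ 2 + r * x)) ∂(gaussianReal 0 h) =
      ENNReal.ofReal ((√γ)⁻¹ * exp (r ^ 2 * h / (2 * γ))) := by
  rw [gaussianReal_of_var_ne_zero _ hh,
    lintegral_withDensity_eq_lintegral_mul _ (measurable_gaussianPDF _ _) (by fun_prop)]
  simp only [Pi.mul_apply, gaussianPDF, ← ENNReal.ofReal_mul (gaussianPDFReal_nonneg _ _ _),
    gaussianPDFReal_mul_exp_quadratic hh hγ hp]
  simp only [ENNReal.ofReal_mul (show 0 ≤ (√(γ : ℝ))⁻¹ * exp (r ^ 2 * h / (2 * γ)) by positivity)]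
  rw [lintegral_const_mul _ (by fun_prop),
    lintegral_gaussianPDFReal_eq_one _ (div_ne_zero hh hγ), mul_one]

variable {E : Type*} [NormedAddCommGroup E]

/-- The exponential square moments of `Z`, about every centre, are at most those of a centred real
Gaussian variable of variance `σ`, the centre being replaced by its norm. For a Gaussian vector of
a Hilbert space this holds with `σ` the trace of its covariance. -/
def HasSubgaussianSqMGF (Z : Ω → E) (σ : ℝ) (P : Measure Ω) : Prop :=
  ∀ a, 0 ≤ a → a * σ < 1 → ∀ v : E,
    ∫⁻ ω, ENNReal.ofReal (exp (a / 2 * ‖v + Z ω‖ ^ 2)) ∂P ≤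
      ENNReal.ofReal ((√(1 - a * σ))⁻¹ * exp (a / (1 - a * σ) / 2 * ‖v‖ ^ 2))

namespace HasSubgaussianSqMGF

lemma zero [IsProbabilityMeasure P] : HasSubgaussianSqMGF (fun _ => (0 : E)) 0 P :=
  fun a _ _ v => by simp

lemma mono {Z : Ω → E} {σ σ' : ℝ} (hZ : HasSubgaussianSqMGF Z σ P) (hσ : σ ≤ σ') :
    HasSubgaussianSqMGF Z σ' P := fun a ha haσ v => by
  have hle : 1 - a * σ' ≤ 1 - a * σ := by gcongr
  have : 0 < 1 - a * σ' := by linarith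
  refine (hZ a ha (by linarith) v).trans (ENNReal.ofReal_le_ofReal ?_)
  gcongr

variable [MeasurableSpace E] [BorelSpace E]

lemma of_map_eq_gaussianReal [InnerProductSpace ℝ E] {ξ : Ω → ℝ} (hξ : Measurable ξ) {h : ℝ≥0}
    (hh : h ≠ 0) (hlaw : P.map ξ = gaussianReal 0 h) (s : E) :
    HasSubgaussianSqMGF (fun ω => ξ ω • s) (h * ‖s‖ ^ 2) P := fun a _ haσ v => by
  obtain ⟨γ, hγ⟩ : ∃ γ : ℝ≥0, (γ : ℝ) = 1 - a * (h * ‖s‖ ^ 2) := ⟨⟨_, by linarith⟩, rfl⟩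
  have hγ0 : 0 < (γ : ℝ) := by linarith
  have hexpand : ∀ x : ℝ, exp (a / 2 * ‖v + x • s‖ ^ 2) =
      exp (a / 2 * ‖v‖ ^ 2) * exp (a / 2 * ‖s‖ ^ 2 * x ^ 2 + a * inner ℝ v s * x) := fun x => by
    rw [← exp_add, norm_add_sq_real, norm_smul, inner_smul_right, mul_pow, Real.norm_eq_abs, sq_abs]
    ring_nf
  have hCS : (a * inner ℝ v s) ^ 2 ≤ a ^ 2 * (‖v‖ ^ 2 * ‖s‖ ^ 2) := by
    rw [mul_pow, ← mul_pow ‖v‖, ← sq_abs (inner ℝ v s)]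
    gcongr
    exact abs_real_inner_le_norm v s
  calc ∫⁻ ω, ENNReal.ofReal (exp (a / 2 * ‖v + ξ ω • s‖ ^ 2)) ∂P
      = ∫⁻ x, ENNReal.ofReal (exp (a / 2 * ‖v + x • s‖ ^ 2)) ∂(gaussianReal 0 h) := by
        rw [← hlaw, lintegral_map (by fun_prop) hξ]
    _ = ENNReal.ofReal (exp (a / 2 * ‖v‖ ^ 2) *
          ((√γ)⁻¹ * exp ((a * inner ℝ v s) ^ 2 * h / (2 * γ)))) := by
        simp only [hexpand, ENNReal.ofReal_mul (exp_nonneg _)]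
        rw [lintegral_const_mul _ (by fun_prop), lintegral_exp_quadratic_gaussianReal hh
          (by simpa using hγ0.ne') (by rw [hγ]; ring)]
    _ ≤ ENNReal.ofReal (exp (a / 2 * ‖v‖ ^ 2) *
          ((√γ)⁻¹ * exp (a ^ 2 * (‖v‖ ^ 2 * ‖s‖ ^ 2) * h / (2 * γ)))) := by gcongr
    _ = _ := by
        rw [← hγ, mul_left_comm, ← exp_add]
        congr 3
        field_simp
        rw [hγ]
        ring

lemma of_tendsto {Z : ℕ → Ω → E} {Y : Ω → E} {σ : ℝ} (hZ : ∀ n, HasSubgaussianSqMGF (Z n) σ P)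
    (hm : ∀ n, AEMeasurable (Z n) P)
    (hlim : ∀ᵐ ω ∂P, Tendsto (fun n => Z n ω) atTop (𝓝 (Y ω))) :
    HasSubgaussianSqMGF Y σ P := fun a ha haσ v => by
  set F : E → ℝ≥0∞ := fun z => ENNReal.ofReal (exp (a / 2 * ‖v + z‖ ^ 2))
  have hFc : Continuous F := ENNReal.continuous_ofReal.comp (by fun_prop)
  calc ∫⁻ ω, F (Y ω) ∂P
      = ∫⁻ ω, liminf (fun n => F (Z n ω)) atTop ∂P := by
        refine lintegral_congr_ae ?_
        filter_upwards [hlim] with ω hω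
        exact ((hFc.tendsto _).comp hω).liminf_eq.symm
    _ ≤ liminf (fun n => ∫⁻ ω, F (Z n ω) ∂P) atTop :=
        lintegral_liminf_le' fun n => hFc.measurable.comp_aemeasurable (hm n)
    _ ≤ _ := (liminf_le_liminf (Eventually.of_forall fun n => hZ n a ha haσ v)).trans (by simp)

variable [SecondCountableTopology E]

lemma add [IsFiniteMeasure P] {Z Z' : Ω → E} {σ σ' : ℝ} (hσ : 0 ≤ σ)
    (hZ : HasSubgaussianSqMGF Z σ P) (hZ' : HasSubgaussianSqMGF Z' σ' P)
    (hind : IndepFun Z Z' P) (hm : AEMeasurable Z P) (hm' : AEMeasurable Z' P) :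
    HasSubgaussianSqMGF (fun ω => Z ω + Z' ω) (σ + σ') P := fun a ha haσ v => by
  have haσ0 : 0 ≤ a * σ := by positivity
  set γ : ℝ := 1 - a * σ' with hγ
  have hγ0 : 0 < γ := by nlinarith
  have hγσ : 1 - a / γ * σ = (1 - a * (σ + σ')) / γ := by
    field_simp
    rw [hγ]
    ring
  have hpos : 0 < 1 - a * (σ + σ') := by linarith
  calc ∫⁻ ω, ENNReal.ofReal (exp (a / 2 * ‖v + (Z ω + Z' ω)‖ ^ 2)) ∂P
      ≤ ∫⁻ ω, ENNReal.ofReal ((√γ)⁻¹ * exp (a / γ / 2 * ‖v + Z ω‖ ^ 2)) ∂P := by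
        refine lintegral_comp_le_of_indepFun hind hm hm'
          (F := fun z z' => ENNReal.ofReal (exp (a / 2 * ‖v + (z + z')‖ ^ 2)))
          (G := fun z => ENNReal.ofReal ((√γ)⁻¹ * exp (a / γ / 2 * ‖v + z‖ ^ 2)))
          (by fun_prop) fun z => ?_
        simpa only [add_assoc] using hZ' a ha (by linarith) (v + z)
    _ = ENNReal.ofReal (√γ)⁻¹ * ∫⁻ ω, ENNReal.ofReal (exp (a / γ / 2 * ‖v + Z ω‖ ^ 2)) ∂P := by
        simp only [ENNReal.ofReal_mul (show 0 ≤ (√γ)⁻¹ by positivity)]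
        exact lintegral_const_mul'' _ (by fun_prop)
    _ ≤ ENNReal.ofReal (√γ)⁻¹ * ENNReal.ofReal
          ((√(1 - a / γ * σ))⁻¹ * exp (a / γ / (1 - a / γ * σ) / 2 * ‖v‖ ^ 2)) := by
        gcongr
        exact hZ _ (by positivity) (by rw [← sub_pos, hγσ]; positivity) v
    _ = _ := by
        rw [← ENNReal.ofReal_mul (by positivity), hγσ, Real.sqrt_div hpos.le]
        congr 1
        field_simp

lemma sum [IsProbabilityMeasure P] {ι : Type*} {Z : ι → Ω → E} {σ : ι → ℝ} (hσ : ∀ i, 0 ≤ σ i)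
    (hZ : ∀ i, HasSubgaussianSqMGF (Z i) (σ i) P) (hind : iIndepFun Z P)
    (hm : ∀ i, AEMeasurable (Z i) P) (s : Finset ι) :
    HasSubgaussianSqMGF (fun ω => ∑ i ∈ s, Z i ω) (∑ i ∈ s, σ i) P := by
  classical
  induction s using Finset.induction_on with
  | empty => simpa using zero
  | insert i s hi ih =>
    simp only [Finset.sum_insert hi, add_comm (Z i _), add_comm (σ i)]
    refine ih.add (Finset.sum_nonneg fun j _ => hσ j) (hZ i) ?_ (by fun_prop) (hm i)
    simpa only [Finset.sum_fn] using hind.indepFun_finsetSum_of_notMem₀ hm hi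

lemma of_tendsto_gaussian_series [InnerProductSpace ℝ E] [IsProbabilityMeasure P]
    {ξ : ℕ → Ω → ℝ} (hξ : ∀ k, Measurable (ξ k)) (hind : iIndepFun ξ P) {h : ℝ≥0} (hh : h ≠ 0)
    (hlaw : ∀ k, P.map (ξ k) = gaussianReal 0 h) {s : ℕ → E} {τ : ℝ}
    (hs : ∀ K, ∑ k ∈ Finset.range K, ‖s k‖ ^ 2 ≤ τ) {Y : Ω → E}
    (hlim : ∀ᵐ ω ∂P, Tendsto (fun K => ∑ k ∈ Finset.range K, ξ k ω • s k) atTop (𝓝 (Y ω))) :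
    HasSubgaussianSqMGF Y (h * τ) P := by
  have hterm : iIndepFun (fun k ω => ξ k ω • s k) P :=
    hind.comp (fun k x => x • s k) fun k => by fun_prop
  refine of_tendsto (fun K => ?_) (fun K => by fun_prop) hlim
  refine (sum (fun k => by positivity) (fun k => of_map_eq_gaussianReal (hξ k) hh (hlaw k) (s k))
    hterm (fun k => by fun_prop) (Finset.range K)).mono ?_
  rw [← Finset.mul_sum]
  gcongr
  exact hs K

end HasSubgaussianSqMGF

end SquareMGF

section Discount

variable {τ α t h : ℝ}

lemma exp_neg_mul_le_one_sub (hτ : 0 ≤ τ) (hα : τ ≤ α) (ht : 0 ≤ t) {s : ℝ} (hs : 0 ≤ s)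
    (hsh : s ≤ h) : exp (-α * s) ≤ 1 - exp (-α * (t + h)) * (s * τ) := by
  have : 0 ≤ α := hτ.trans hα
  have hmono : exp (-α * (t + h)) * (s * τ) ≤ exp (-α * s) * (s * α) := by
    gcongr ?_ * ?_
    · exact exp_le_exp.2 (by nlinarith)
    · gcongr
  have htangent : exp (-α * s) * (α * s + 1) ≤ 1 := by
    rw [neg_mul, exp_neg, inv_mul_le_one₀ (exp_pos _)]
    exact add_one_le_exp _
  linarith

lemma exp_mul_lt_one (hτ : 0 ≤ τ) (hα : τ ≤ α) (ht : 0 ≤ t) (hh : 0 ≤ h) :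
    exp (-α * (t + h)) * (h * τ) < 1 := by
  linarith [exp_neg_mul_le_one_sub hτ hα ht hh le_rfl, exp_pos (-α * h)]

lemma exp_div_one_sub_le (hτ : 0 ≤ τ) (hα : τ ≤ α) (ht : 0 ≤ t) {s : ℝ} (hs : 0 ≤ s)
    (hsh : s ≤ h) :
    exp (-α * (t + h)) / (1 - exp (-α * (t + h)) * (s * τ)) ≤ exp (-α * (t + h - s)) := by
  have hle := exp_neg_mul_le_one_sub hτ hα ht hs hsh
  rw [div_le_iff₀ ((exp_pos _).trans_le hle)]
  calc exp (-α * (t + h)) = exp (-α * (t + h - s)) * exp (-α * s) := by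
        rw [← exp_add]; ring_nf
    _ ≤ _ := by gcongr

lemma neg_log_one_sub_le_integral (hτ : 0 ≤ τ) (hα : τ ≤ α) (ht : 0 ≤ t) (hh : 0 ≤ h) :
    -log (1 - exp (-α * (t + h)) * (h * τ)) ≤ ∫ s in t..(t + h), τ * exp (-α * s) := by
  set a := exp (-α * (t + h))
  have hpos : ∀ s ∈ Set.Icc 0 h, 0 < 1 - a * (s * τ) := fun s hs =>
    (exp_pos _).trans_le (exp_neg_mul_le_one_sub hτ hα ht hs.1 hs.2)
  have hderiv : ∀ s ∈ Set.Icc 0 h,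
      HasDerivAt (fun s => -log (1 - a * (s * τ))) (τ * (a / (1 - a * (s * τ)))) s := by
    intro s hs
    have hlin : HasDerivAt (fun s => 1 - a * (s * τ)) (-(a * τ)) s := by
      simpa using (((hasDerivAt_id s).mul_const τ).const_mul a).const_sub 1
    exact (hlin.log (hpos s hs).ne').neg.congr_deriv (by ring)
  have hle := intervalIntegral.sub_le_integral_of_hasDeriv_right_of_le hh
    (fun s hs => (hderiv s hs).continuousAt.continuousWithinAt)
    (fun s hs => (hderiv s (Set.Ioo_subset_Icc_self hs)).hasDerivWithinAt)
    (φ := fun s => τ * exp (-α * (t + h - s)))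
    (Continuous.integrableOn_Icc (by fun_prop))
    (fun s hs => mul_le_mul_of_nonneg_left (exp_div_one_sub_le hτ hα ht hs.1.le hs.2.le) hτ)
  rw [intervalIntegral.integral_comp_sub_left (fun s => τ * exp (-α * s))] at hle
  simpa using hle

lemma inv_sqrt_one_sub_le_exp_integral (hτ : 0 ≤ τ) (hα : τ ≤ α) (ht : 0 ≤ t) (hh : 0 ≤ h) :
    (√(1 - exp (-α * (t + h)) * (h * τ)))⁻¹ ≤
      exp (∫ s in t..(t + h), 1 / 2 * τ * exp (-α * s)) := by
  have hpos : 0 < 1 - exp (-α * (t + h)) * (h * τ) := sub_pos.2 (exp_mul_lt_one hτ hα ht hh)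
  have hlog := neg_log_one_sub_le_integral hτ hα ht hh
  rw [← exp_log (Real.sqrt_pos.2 hpos), log_sqrt hpos.le, ← exp_neg, exp_le_exp]
  simp only [mul_assoc, intervalIntegral.integral_const_mul] at hlog ⊢
  linarith

end Discount

section Trajectory

variable {E : Type*} [NormedAddCommGroup E]

/-- The trajectory of a splitting scheme on position-velocity pairs: each deterministic `step` is
followed by a kick `ζ m` of the velocity. -/
def trajectory (step : E × E → E × E) (x₀ : E × E) (ζ : ℕ → E) : ℕ → E × E
  | 0 => x₀
  | m + 1 => ((step (trajectory step x₀ ζ m)).1, (step (trajectory step x₀ ζ m)).2 + ζ m)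

lemma trajectory_congr (step : E × E → E × E) (x₀ : E × E) {ζ ζ' : ℕ → E} {m : ℕ}
    (h : ∀ j < m, ζ j = ζ' j) : trajectory step x₀ ζ m = trajectory step x₀ ζ' m := by
  induction m with
  | zero => rfl
  | succ m ih => simp only [trajectory, ih fun j hj => h j (by omega), h m (by omega)]

lemma continuous_trajectory {step : E × E → E × E} (hstep : Continuous step) (x₀ : E × E) (m : ℕ) :
    Continuous fun ζ : ℕ → E => trajectory step x₀ ζ m := by
  induction m with
  | zero => exact continuous_const
  | succ m ih =>
    simp only [trajectory]
    fun_prop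

variable [MeasurableSpace E] [BorelSpace E] {Ω : Type*} [MeasurableSpace Ω] {P : Measure Ω}

/- The discount `exp (-α s)` with `α ≥ τ` absorbs the growth factor `1 / (1 - a h τ)` of the
velocity in the subgaussian bound, where `a = exp (-α (t + h))`. -/
lemma HasSubgaussianSqMGF.lintegral_exp_discounted_le {Z : Ω → E} {τ α t h : ℝ} (hh : 0 ≤ h)
    (hZ : HasSubgaussianSqMGF Z (h * τ) P) (hτ : 0 ≤ τ) (hα : τ ≤ α) (ht : 0 ≤ t)
    (hm : AEMeasurable Z P) {r : ℝ} (hr : 0 ≤ r) (v : E) :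
    ∫⁻ ω, ENNReal.ofReal (exp ((r + 1 / 2 * ‖v + Z ω‖ ^ 2) * exp (-α * (t + h)))) ∂P ≤
      ENNReal.ofReal (exp (∫ s in t..(t + h), 1 / 2 * τ * exp (-α * s))) *
        ENNReal.ofReal (exp ((r + 1 / 2 * ‖v‖ ^ 2) * exp (-α * t))) := by
  set a := exp (-α * (t + h))
  have ha_div : a / (1 - a * (h * τ)) ≤ exp (-α * t) := by
    simpa only [add_sub_cancel_right] using exp_div_one_sub_le hτ hα ht hh le_rfl
  have ha_le : a ≤ exp (-α * t) := exp_le_exp.2 (by nlinarith [hτ.trans hα])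
  have hsplit : ∀ w : E, ENNReal.ofReal (exp ((r + 1 / 2 * ‖w‖ ^ 2) * a)) =
      ENNReal.ofReal (exp (r * a)) * ENNReal.ofReal (exp (a / 2 * ‖w‖ ^ 2)) := fun w => by
    rw [← ENNReal.ofReal_mul (exp_nonneg _), ← exp_add]
    ring_nf
  calc ∫⁻ ω, ENNReal.ofReal (exp ((r + 1 / 2 * ‖v + Z ω‖ ^ 2) * a)) ∂P
      = ENNReal.ofReal (exp (r * a)) * ∫⁻ ω, ENNReal.ofReal (exp (a / 2 * ‖v + Z ω‖ ^ 2)) ∂P := by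
        simp only [hsplit]
        exact lintegral_const_mul'' _
          ((show Continuous fun z => ENNReal.ofReal (exp (a / 2 * ‖v + z‖ ^ 2)) from
            ENNReal.continuous_ofReal.comp (by fun_prop)).measurable.comp_aemeasurable hm)
    _ ≤ ENNReal.ofReal (exp (r * a)) * ENNReal.ofReal ((√(1 - a * (h * τ)))⁻¹ *
          exp (a / (1 - a * (h * τ)) / 2 * ‖v‖ ^ 2)) := by
        gcongr
        exact hZ a (exp_nonneg _) (exp_mul_lt_one hτ hα ht hh) v
    _ ≤ ENNReal.ofReal (exp (r * exp (-α * t))) * ENNReal.ofReal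
          (exp (∫ s in t..(t + h), 1 / 2 * τ * exp (-α * s)) *
            exp (exp (-α * t) / 2 * ‖v‖ ^ 2)) := by
        gcongr
        exact inv_sqrt_one_sub_le_exp_integral hτ hα ht hh
    _ = _ := by
        rw [← ENNReal.ofReal_mul (exp_nonneg _), ← ENNReal.ofReal_mul (exp_nonneg _)]
        simp only [← exp_add]
        ring_nf

variable [SecondCountableTopology E] {step : E × E → E × E} {ζ : ℕ → Ω → E}

lemma aemeasurable_trajectory (hstep : Continuous step) (hm : ∀ j, AEMeasurable (ζ j) P)
    (x₀ : E × E) (m : ℕ) : AEMeasurable (fun ω => trajectory step x₀ (fun j => ζ j ω) m) P :=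
  (continuous_trajectory hstep x₀ m).measurable.comp_aemeasurable (aemeasurable_pi_lambda _ hm)

lemma indepFun_trajectory (hstep : Continuous step) (hind : iIndepFun ζ P)
    (hm : ∀ j, AEMeasurable (ζ j) P) (x₀ : E × E) (m : ℕ) :
    IndepFun (fun ω => trajectory step x₀ (fun j => ζ j ω) m) (ζ m) P := by
  classical
  have hpast := hind.indepFun_finset₀ (Finset.range m) {m} (by simp) hm
  set extend : (Finset.range m → E) → ℕ → E :=
    fun y j => if hj : j ∈ Finset.range m then y ⟨j, hj⟩ else 0 with hextend
  have hextend_meas : Measurable extend := measurable_pi_iff.2 fun j => by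
    simp only [hextend]
    split_ifs <;> fun_prop
  convert hpast.comp ((continuous_trajectory hstep x₀ m).measurable.comp hextend_meas)
    (measurable_pi_apply (⟨m, Finset.mem_singleton_self m⟩ : ({m} : Finset ℕ))) using 1
  · funext ω
    exact trajectory_congr _ _ fun j hj => by simp [hextend, hj]
  · rfl

lemma lintegral_exp_energy_kick_le [IsFiniteMeasure P] (hstep : Measurable step) {U : E → ℝ}
    (hU : Measurable U) (hU0 : ∀ x, 0 ≤ U x)
    (hcons : ∀ p, U (step p).1 + 1 / 2 * ‖(step p).2‖ ^ 2 = U p.1 + 1 / 2 * ‖p.2‖ ^ 2)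
    {τ α t h : ℝ} (hh : 0 ≤ h) (hτ : 0 ≤ τ) (hα : τ ≤ α) (ht : 0 ≤ t) {X : Ω → E × E} {Z : Ω → E}
    (hXZ : IndepFun X Z P) (hX : AEMeasurable X P) (hm : AEMeasurable Z P)
    (hZ : HasSubgaussianSqMGF Z (h * τ) P) :
    ∫⁻ ω, ENNReal.ofReal (exp ((U (step (X ω)).1 + 1 / 2 * ‖(step (X ω)).2 + Z ω‖ ^ 2) *
      exp (-α * (t + h)))) ∂P ≤
      ENNReal.ofReal (exp (∫ s in t..(t + h), 1 / 2 * τ * exp (-α * s))) *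
        ∫⁻ ω, ENNReal.ofReal (exp ((U (X ω).1 + 1 / 2 * ‖(X ω).2‖ ^ 2) * exp (-α * t))) ∂P := by
  rw [← lintegral_const_mul'' _ (by fun_prop)]
  refine lintegral_comp_le_of_indepFun hXZ hX hm
    (F := fun x z => ENNReal.ofReal
      (exp ((U (step x).1 + 1 / 2 * ‖(step x).2 + z‖ ^ 2) * exp (-α * (t + h)))))
    (G := fun x => ENNReal.ofReal (exp (∫ s in t..(t + h), 1 / 2 * τ * exp (-α * s))) *
      ENNReal.ofReal (exp ((U x.1 + 1 / 2 * ‖x.2‖ ^ 2) * exp (-α * t)))) (by fun_prop) fun x => ?_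
  rw [← hcons x]
  exact hZ.lintegral_exp_discounted_le hh hτ hα ht hm (hU0 _) _

lemma lintegral_exp_energy_trajectory_le [IsProbabilityMeasure P] (hstep : Continuous step)
    {U : E → ℝ} (hU : Measurable U) (hU0 : ∀ x, 0 ≤ U x)
    (hcons : ∀ p, U (step p).1 + 1 / 2 * ‖(step p).2‖ ^ 2 = U p.1 + 1 / 2 * ‖p.2‖ ^ 2)
    {τ α h : ℝ} (hh : 0 ≤ h) (hτ : 0 ≤ τ) (hα : τ ≤ α) (hind : iIndepFun ζ P)
    (hm : ∀ j, AEMeasurable (ζ j) P) (hζ : ∀ j, HasSubgaussianSqMGF (ζ j) (h * τ) P)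
    (x₀ : E × E) (m : ℕ) :
    ∫⁻ ω, ENNReal.ofReal (exp ((U (trajectory step x₀ (fun j => ζ j ω) m).1 +
      1 / 2 * ‖(trajectory step x₀ (fun j => ζ j ω) m).2‖ ^ 2) * exp (-α * (m * h)))) ∂P ≤
      ENNReal.ofReal (exp (U x₀.1 + 1 / 2 * ‖x₀.2‖ ^ 2 +
        ∫ s in (0 : ℝ)..(m * h), 1 / 2 * τ * exp (-α * s))) := by
  induction m with
  | zero => simp [trajectory]
  | succ m ih =>
    have hcont : Continuous fun s => 1 / 2 * τ * exp (-α * s) := by fun_prop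
    have hadd := intervalIntegral.integral_add_adjacent_intervals (μ := volume)
      (hcont.intervalIntegrable 0 (m * h)) (hcont.intervalIntegrable (m * h) (m * h + h))
    rw [show ((m + 1 : ℕ) : ℝ) * h = m * h + h by push_cast; ring]
    refine (lintegral_exp_energy_kick_le hstep.measurable hU hU0 hcons hh hτ hα (by positivity)
      (indepFun_trajectory hstep hind hm x₀ m) (aemeasurable_trajectory hstep hm x₀ m) (hm m)
      (hζ m)).trans ((mul_le_mul_right ih _).trans_eq ?_)
    rw [← ENNReal.ofReal_mul (exp_nonneg _), ← exp_add, ← hadd]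
    ring_nf

end Trajectory

section Noise

variable {Ω : Type*} [MeasurableSpace Ω] {P : Measure Ω}

lemma iIndepFun_curry [IsProbabilityMeasure P] {ι κ 𝓧 : Type*} [MeasurableSpace 𝓧]
    {X : ι × κ → Ω → 𝓧} (hX : ∀ p, Measurable (X p)) (hind : iIndepFun X P) :
    iIndepFun (fun i ω j => X (i, j) ω) P := by
  have : ∀ i j, IsProbabilityMeasure (P.map (X (i, j))) := fun i j =>
    Measure.isProbabilityMeasure_map (hX _).aemeasurable
  rw [iIndepFun_iff_map_fun_eq_infinitePi_map (by fun_prop)]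
  calc P.map (fun ω i j => X (i, j) ω)
      = (P.map fun ω p => X p ω).map (MeasurableEquiv.curry ι κ 𝓧) := by
        rw [Measure.map_map (by fun_prop) (by fun_prop)]
        rfl
    _ = Measure.infinitePi fun i => Measure.infinitePi fun j => P.map (X (i, j)) := by
        rw [(iIndepFun_iff_map_fun_eq_infinitePi_map hX).1 hind]
        exact Measure.infinitePi_map_curry fun i j => P.map (X (i, j))
    _ = Measure.infinitePi fun i => P.map fun ω j => X (i, j) ω := by
        congr with i : 1
        exact ((iIndepFun_iff_map_fun_eq_infinitePi_map fun j => hX (i, j)).1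
          (hind.precomp (Prod.mk_right_injective i))).symm

lemma iIndepFun_of_tendsto_series [IsProbabilityMeasure P] {E : Type*} [NormedAddCommGroup E]
    [NormedSpace ℝ E] [CompleteSpace E] [SecondCountableTopology E] [MeasurableSpace E]
    [BorelSpace E] {ι : Type*} {ξ : ℕ × ι → Ω → ℝ} (hξ : ∀ p, Measurable (ξ p))
    (hind : iIndepFun ξ P) {s : ℕ → E} {ζ : ι → Ω → E} (hlim : ∀ j, ∀ᵐ ω ∂P,
      Tendsto (fun K => ∑ k ∈ Finset.range K, ξ (k, j) ω • s k) atTop (𝓝 (ζ j ω))) :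
    iIndepFun ζ P := by
  have hcol : iIndepFun (fun j ω k => ξ (k, j) ω) P :=
    iIndepFun_curry (fun p => hξ p.swap) (hind.precomp Prod.swap_injective)
  have hsum : Measurable fun y : ℕ → ℝ =>
      limUnder atTop fun K => ∑ k ∈ Finset.range K, y k • s k :=
    (StronglyMeasurable.limUnder fun K =>
      (show Continuous fun y : ℕ → ℝ => ∑ k ∈ Finset.range K, y k • s k by
        fun_prop).stronglyMeasurable).measurable
  refine (iIndepFun_congr fun j => ?_).1 (hcol.comp _ fun _ => hsum)
  filter_upwards [hlim j] with ω hω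
  exact hω.limUnder_eq

lemma exists_gaussian_increments {ι : Type*} [Countable ι] {β : ι → ℝ≥0 → Ω → ℝ}
    (hβ : ∀ k, IsBrownianReal (β k) P) (hind : iIndepFun (fun k ω t => β k t ω) P)
    {t : ℕ → ℝ≥0} (ht : Monotone t) :
    ∃ ξ : ι × ℕ → Ω → ℝ, (∀ p, Measurable (ξ p)) ∧ iIndepFun ξ P ∧
      (∀ k j, P.map (ξ (k, j)) = gaussianReal 0 (nndist (t (j + 1) : ℝ) (t j))) ∧
      ∀ᵐ ω ∂P, ∀ k j, β k (t (j + 1)) ω - β k (t j) ω = ξ (k, j) ω := by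
  have hm : ∀ k j, AEMeasurable (fun ω => β k (t (j + 1)) ω - β k (t j) ω) P := fun k j =>
    ((hβ k).aemeasurable _).sub ((hβ k).aemeasurable _)
  have hae : ∀ᵐ ω ∂P, ∀ k j, β k (t (j + 1)) ω - β k (t j) ω = (hm k j).mk _ ω :=
    ae_all_iff.2 fun k => ae_all_iff.2 fun j => (hm k j).ae_eq_mk
  refine ⟨fun p => (hm p.1 p.2).mk _, fun p => (hm p.1 p.2).measurable_mk,
    iIndepFun_uncurry' (fun k j => (hm k j).measurable_mk) ?_ fun k => ?_, fun k j => ?_, hae⟩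
  · refine (iIndepFun_congr fun k => ?_).1 (hind.comp
      (fun _ (p : ℝ≥0 → ℝ) (j : ℕ) => p (t (j + 1)) - p (t j)) fun _ => by fun_prop)
    filter_upwards [hae] with ω hω
    exact funext (hω k)
  · exact (iIndepFun_congr fun j => (hm k j).ae_eq_mk).1 ((hβ k).hasIndepIncrements.nat ht)
  · rw [← Measure.map_congr (hm k j).ae_eq_mk]
    exact ((hβ k).hasLaw_sub (t (j + 1)) (t j)).map_eq

variable {d : ℕ} {S : L2 d →L[ℝ] L2 d} {W : ℝ≥0 → Ω → L2 d} {E : Type*} [NormedAddCommGroup E]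
  [NormedSpace ℝ E] {h : ℝ}

lemma monotone_gridTime (hh : 0 ≤ h) : Monotone (gridTime h) := fun m n hmn => by
  unfold gridTime
  gcongr

lemma nndist_gridTime_succ (hh : 0 ≤ h) (j : ℕ) :
    nndist (gridTime h (j + 1) : ℝ) (gridTime h j) = h.toNNReal := by
  apply NNReal.coe_injective
  rw [coe_nndist, Real.dist_eq, gridTime, gridTime, Real.coe_toNNReal _ (by positivity),
    Real.coe_toNNReal _ (by positivity), Real.coe_toNNReal _ hh, ← sub_mul]
  simpa using hh

lemma IsWienerProcess.exists_increments_series (hW : IsWienerProcess S P W)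
    (hh : 0 ≤ h) (A : L2 d →L[ℝ] E) :
    ∃ (b : HilbertBasis ℕ ℝ (L2 d)) (ξ : ℕ × ℕ → Ω → ℝ), (∀ p, Measurable (ξ p)) ∧
      iIndepFun ξ P ∧ (∀ k j, P.map (ξ (k, j)) = gaussianReal 0 h.toNNReal) ∧
      ∀ j, ∀ᵐ ω ∂P, Tendsto (fun K => ∑ k ∈ Finset.range K, ξ (k, j) ω • A (S (b k))) atTop
        (𝓝 (A (W (gridTime h (j + 1)) ω - W (gridTime h j) ω))) := by
  obtain ⟨b, β, hβ, hind, hlim⟩ := hW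
  obtain ⟨ξ, hξ, hξind, hlaw, hae⟩ := exists_gaussian_increments hβ hind (monotone_gridTime hh)
  refine ⟨b, ξ, hξ, hξind, fun k j => (hlaw k j).trans (by rw [nndist_gridTime_succ hh]),
    fun j => ?_⟩
  filter_upwards [hae, hlim (gridTime h j), hlim (gridTime h (j + 1))] with ω hω hj hj'
  refine ((A.continuous.tendsto _).comp (hj'.sub hj)).congr fun K => ?_
  simp only [Function.comp_apply, ← Finset.sum_sub_distrib, ← sub_smul, hω, map_sum, map_smul]

variable [MeasurableSpace E] [BorelSpace E] [SecondCountableTopology E]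

lemma IsWienerProcess.aemeasurable_increment (hW : IsWienerProcess S P W) (hh : 0 ≤ h)
    (A : L2 d →L[ℝ] E) (j : ℕ) :
    AEMeasurable (fun ω => A (W (gridTime h (j + 1)) ω - W (gridTime h j) ω)) P := by
  obtain ⟨b, ξ, hξ, -, -, hlim⟩ := hW.exists_increments_series hh A
  exact aemeasurable_of_tendsto_metrizable_ae atTop (fun K => by fun_prop) (hlim j)

variable [IsProbabilityMeasure P]

lemma IsWienerProcess.iIndepFun_increments [CompleteSpace E] (hW : IsWienerProcess S P W)
    (hh : 0 ≤ h) (A : L2 d →L[ℝ] E) :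
    iIndepFun (fun j ω => A (W (gridTime h (j + 1)) ω - W (gridTime h j) ω)) P := by
  obtain ⟨b, ξ, hξ, hind, -, hlim⟩ := hW.exists_increments_series hh A
  exact iIndepFun_of_tendsto_series hξ hind hlim

lemma IsWienerProcess.hasSubgaussianSqMGF_increment {E : Type*} [NormedAddCommGroup E]
    [InnerProductSpace ℝ E] [MeasurableSpace E] [BorelSpace E] [SecondCountableTopology E]
    (hW : IsWienerProcess S P W) (hh : 0 < h) (A : L2 d →L[ℝ] E) {τ : ℝ}
    (hτ : ∀ (b : HilbertBasis ℕ ℝ (L2 d)) (K : ℕ), ∑ k ∈ Finset.range K, ‖A (S (b k))‖ ^ 2 ≤ τ)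
    (j : ℕ) :
    HasSubgaussianSqMGF (fun ω => A (W (gridTime h (j + 1)) ω - W (gridTime h j) ω))
      (h * τ) P := by
  obtain ⟨b, ξ, hξ, hind, hlaw, hlim⟩ := hW.exists_increments_series hh.le A
  simpa only [Real.coe_toNNReal h hh.le] using HasSubgaussianSqMGF.of_tendsto_gaussian_series
    (fun k => hξ (k, j)) (hind.precomp (Prod.mk_left_injective j)) (Real.toNNReal_pos.2 hh).ne'
    (fun k => hlaw k j) (hτ b) (hlim j)

end Noise

section Sobolev

lemma sq_lintegral_mul_le {X : Type*} [MeasurableSpace X] {μ : Measure X} {f g : X → ℝ≥0∞}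
    (hf : AEMeasurable f μ) (hg : AEMeasurable g μ) :
    (∫⁻ x, f x * g x ∂μ) ^ 2 ≤ (∫⁻ x, f x ^ 2 ∂μ) * ∫⁻ x, g x ^ 2 ∂μ := by
  calc (∫⁻ x, f x * g x ∂μ) ^ 2
      ≤ ((∫⁻ x, f x ^ (2 : ℝ) ∂μ) ^ (1 / (2 : ℝ)) *
          (∫⁻ x, g x ^ (2 : ℝ) ∂μ) ^ (1 / (2 : ℝ))) ^ 2 := by
        gcongr
        exact ENNReal.lintegral_mul_le_Lp_mul_Lq μ Real.HolderConjugate.two_two hf hg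
    _ = (∫⁻ x, f x ^ 2 ∂μ) * ∫⁻ x, g x ^ 2 ∂μ := by
        rw [mul_pow, ← ENNReal.rpow_natCast, ← ENNReal.rpow_natCast, ← ENNReal.rpow_mul,
          ← ENNReal.rpow_mul]
        norm_num

lemma enorm_le_lintegral_enorm_fderiv {F : Type*} [NormedAddCommGroup F] [NormedSpace ℝ F]
    {ψ : EuclideanSpace ℝ (Fin 1) → F} (hψ : ContDiff ℝ 1 ψ) (hc : HasCompactSupport ψ)
    (x : EuclideanSpace ℝ (Fin 1)) : ‖ψ x‖ₑ ≤ ∫⁻ y, ‖fderiv ℝ ψ y‖ₑ := by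
  let L : ℝ ≃ₗᵢ[ℝ] EuclideanSpace ℝ (Fin 1) := (OrthonormalBasis.singleton (Fin 1) ℝ).repr
  have hderiv : ∀ t, deriv (ψ ∘ L) t = fderiv ℝ ψ (L t) (L 1) := fun t =>
    ((hψ.differentiable one_ne_zero (L t)).hasFDerivAt.comp_hasDerivAt t
      (L.toContinuousLinearEquiv.toContinuousLinearMap.hasDerivAt (x := t))).deriv
  calc ‖ψ x‖ₑ = ‖(ψ ∘ L) (L.symm x)‖ₑ := by simp
    _ ≤ ∫⁻ t in Set.Iic (L.symm x), ‖deriv (ψ ∘ L) t‖ₑ :=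
        (hc.comp_homeomorph L.toHomeomorph).enorm_le_lintegral_Ici_deriv (hψ.comp L.contDiff) _
    _ ≤ ∫⁻ t, ‖deriv (ψ ∘ L) t‖ₑ := setLIntegral_le_lintegral _ _
    _ ≤ ∫⁻ t, ‖fderiv ℝ ψ (L t)‖ₑ := by
        refine lintegral_mono fun t => enorm_le_iff_norm_le.2 ?_
        simpa [hderiv t] using (fderiv ℝ ψ (L t)).le_opNorm (L 1)
    _ = ∫⁻ y, ‖fderiv ℝ ψ y‖ₑ :=
        L.measurePreserving.lintegral_comp_emb L.toHomeomorph.measurableEmbedding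
          fun y => ‖fderiv ℝ ψ y‖ₑ

variable {d : ℕ}

lemma volume_cube : volume (cube d : Set (EuclideanSpace ℝ (Fin d))) = 1 := by
  have hcube : (cube d : Set (EuclideanSpace ℝ (Fin d))) =
      (WithLp.ofLp : EuclideanSpace ℝ (Fin d) → Fin d → ℝ) ⁻¹'
        (Set.univ.pi fun _ => Set.Ioo (0 : ℝ) 1) := by
    ext x
    change (∀ i, x i ∈ Set.Ioo (0 : ℝ) 1) ↔ _
    simp [Set.mem_pi]
  rw [hcube, (PiLp.volume_preserving_ofLp (Fin d)).measure_preimage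
    (MeasurableSet.univ_pi fun _ => measurableSet_Ioo).nullMeasurableSet, Real.volume_pi_Ioo]
  simp

instance : IsProbabilityMeasure (cubeMeasure d) :=
  ⟨by rw [cubeMeasure, Measure.restrict_apply_univ, volume_cube]⟩

lemma setLIntegral_enorm_fderiv_eq {s : Set (EuclideanSpace ℝ (Fin d))}
    {ψ : EuclideanSpace ℝ (Fin d) → ℝ} (hψ : tsupport ψ ⊆ s) :
    ∫⁻ x in s, ‖fderiv ℝ ψ x‖ₑ = ∫⁻ x, ‖fderiv ℝ ψ x‖ₑ :=
  setLIntegral_eq_of_support_subset <|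
    (Function.support_comp_subset (g := enorm) enorm_zero (fderiv ℝ ψ)).trans
      ((support_fderiv_subset ℝ).trans hψ)

/- The embedding `W^{1,1} ⊆ L²`: by the fundamental theorem of calculus in dimension one, by
Gagliardo–Nirenberg–Sobolev with the critical exponent in dimension two. -/
lemma exists_lintegral_sq_le_sq_lintegral_fderiv (hd : d = 1 ∨ d = 2) :
    ∃ C : ℝ≥0, ∀ ψ : EuclideanSpace ℝ (Fin d) → ℝ, ContDiff ℝ 1 ψ → HasCompactSupport ψ →
      tsupport ψ ⊆ cube d →
      ∫⁻ x, ‖ψ x‖ₑ ^ 2 ∂cubeMeasure d ≤ C * (∫⁻ x, ‖fderiv ℝ ψ x‖ₑ ∂cubeMeasure d) ^ 2 := by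
  rcases hd with rfl | rfl
  · refine ⟨1, fun ψ hψ hc hsupp => ?_⟩
    rw [cubeMeasure, setLIntegral_enorm_fderiv_eq hsupp]
    calc ∫⁻ x, ‖ψ x‖ₑ ^ 2 ∂cubeMeasure 1
        ≤ ∫⁻ _, (∫⁻ y, ‖fderiv ℝ ψ y‖ₑ) ^ 2 ∂cubeMeasure 1 :=
          lintegral_mono fun x => by gcongr; exact enorm_le_lintegral_enorm_fderiv hψ hc x
      _ = (1 : ℝ≥0) * (∫⁻ y, ‖fderiv ℝ ψ y‖ₑ) ^ 2 := by simp
  · refine ⟨lintegralPowLePowLIntegralFDerivConst (volume : Measure (EuclideanSpace ℝ (Fin 2))) 2,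
      fun ψ hψ hc hsupp => ?_⟩
    rw [cubeMeasure, setLIntegral_enorm_fderiv_eq hsupp]
    have hGNS := lintegral_pow_le_pow_lintegral_fderiv
      (volume : Measure (EuclideanSpace ℝ (Fin 2))) hψ hc (p := 2)
      (by simpa using Real.HolderConjugate.two_two)
    simp only [ENNReal.rpow_ofNat] at hGNS
    exact (setLIntegral_le_lintegral _ _).trans hGNS

lemma contDiff_test (φ : CubeTest d) : ContDiff ℝ 1 φ := φ.contDiff.of_le (by simp)

lemma differentiable_test (φ : CubeTest d) : Differentiable ℝ φ :=
  (contDiff_test φ).differentiable one_ne_zero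

lemma tsupport_pow_subset {X : Type*} [TopologicalSpace X] (φ : X → ℝ) {n : ℕ} (hn : n ≠ 0) :
    tsupport (fun x => φ x ^ n) ⊆ tsupport φ :=
  closure_mono (Function.support_comp_subset (g := (· ^ n)) (zero_pow hn) φ)

/- Apply the embedding `W^{1,1} ⊆ L²` to `φⁿ⁺¹` and Cauchy–Schwarz to `∇φⁿ⁺¹ = (n+1) φⁿ ∇φ`. -/
lemma exists_lintegral_pow_succ_le (hd : d = 1 ∨ d = 2) :
    ∃ C : ℝ≥0, ∀ (φ : CubeTest d) (n : ℕ),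
      ∫⁻ x, ‖φ x‖ₑ ^ (2 * (n + 1)) ∂cubeMeasure d ≤ C * (n + 1) ^ 2 *
        ((∫⁻ x, ‖φ x‖ₑ ^ (2 * n) ∂cubeMeasure d) *
          ∫⁻ x, ‖fderiv ℝ φ x‖ₑ ^ 2 ∂cubeMeasure d) := by
  obtain ⟨C, hC⟩ := exists_lintegral_sq_le_sq_lintegral_fderiv hd
  refine ⟨C, fun φ n => ?_⟩
  have hφ : ContDiff ℝ 1 φ := contDiff_test φ
  have : Measurable φ := φ.continuous.measurable
  have : Measurable (fderiv ℝ φ) := (hφ.continuous_fderiv one_ne_zero).measurable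
  have hsub := tsupport_pow_subset φ n.succ_ne_zero
  have hfderiv : ∀ x, ‖fderiv ℝ (fun x => φ x ^ (n + 1)) x‖ₑ =
      (n + 1) * (‖φ x‖ₑ ^ n * ‖fderiv ℝ φ x‖ₑ) := fun x => by
    rw [fderiv_fun_pow (n + 1) (differentiable_test φ x), enorm_smul, nsmul_eq_mul, enorm_mul,
      enorm_pow, mul_assoc, add_tsub_cancel_right, Real.enorm_natCast]
    push_cast
    rfl
  calc ∫⁻ x, ‖φ x‖ₑ ^ (2 * (n + 1)) ∂cubeMeasure d
      = ∫⁻ x, ‖φ x ^ (n + 1)‖ₑ ^ 2 ∂cubeMeasure d := by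
        simp only [enorm_pow, ← pow_mul, mul_comm 2]
    _ ≤ C * (∫⁻ x, ‖fderiv ℝ (fun x => φ x ^ (n + 1)) x‖ₑ ∂cubeMeasure d) ^ 2 :=
        hC _ (hφ.pow _) (φ.hasCompactSupport.of_isClosed_subset (isClosed_tsupport _) hsub)
          (hsub.trans φ.tsupport_subset)
    _ = C * ((n + 1) ^ 2 * (∫⁻ x, ‖φ x‖ₑ ^ n * ‖fderiv ℝ φ x‖ₑ ∂cubeMeasure d) ^ 2) := by
        simp only [hfderiv]
        rw [lintegral_const_mul _ (by fun_prop), mul_pow]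
    _ ≤ C * ((n + 1) ^ 2 * ((∫⁻ x, (‖φ x‖ₑ ^ n) ^ 2 ∂cubeMeasure d) *
          ∫⁻ x, ‖fderiv ℝ φ x‖ₑ ^ 2 ∂cubeMeasure d)) := by
        gcongr
        exact sq_lintegral_mul_le (by fun_prop) (by fun_prop)
    _ = _ := by simp only [← pow_mul, mul_comm n 2, mul_assoc]

lemma norm_sq_eq_sum_apply_single {ι : Type*} [Fintype ι] [DecidableEq ι]
    (L : EuclideanSpace ℝ ι →L[ℝ] ℝ) : ‖L‖ ^ 2 = ∑ i, L (EuclideanSpace.single i 1) ^ 2 := by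
  set v := (InnerProductSpace.toDual ℝ (EuclideanSpace ℝ ι)).symm L
  have hv : ∀ y, inner ℝ v y = L y := fun y => InnerProductSpace.toDual_symm_apply
  have hnorm : ‖v‖ = ‖L‖ := LinearIsometryEquiv.norm_map _ L
  rw [← hnorm, EuclideanSpace.real_norm_sq_eq]
  exact Finset.sum_congr rfl fun i _ => by
    rw [← hv, EuclideanSpace.inner_single_right]; simp

lemma continuous_partialDeriv (φ : CubeTest d) (i : Fin d) : Continuous (partialDeriv φ i) :=
  ((contDiff_test φ).continuous_fderiv one_ne_zero).clm_apply continuous_const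

lemma lintegral_enorm_fderiv_sq (φ : CubeTest d) :
    ∫⁻ x, ‖fderiv ℝ φ x‖ₑ ^ 2 ∂cubeMeasure d =
      ∑ i, ∫⁻ x, ‖partialDeriv φ i x‖ₑ ^ 2 ∂cubeMeasure d := by
  have hm : ∀ i, Measurable (partialDeriv φ i) := fun i => (continuous_partialDeriv φ i).measurable
  rw [← lintegral_finsetSum _ fun i _ => (hm i).enorm.pow_const 2]
  refine lintegral_congr fun x => ?_
  simp only [← ofReal_norm, ← ENNReal.ofReal_pow (norm_nonneg _)]
  simp only [norm_eq_abs (partialDeriv _ _ _), sq_abs]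
  rw [← ENNReal.ofReal_sum_of_nonneg fun i _ => sq_nonneg _]
  exact congrArg ENNReal.ofReal (norm_sq_eq_sum_apply_single _)

lemma exists_lintegral_pow_six_le_of_test (hd : d = 1 ∨ d = 2) :
    ∃ C : ℝ≥0, ∀ φ : CubeTest d,
      ∫⁻ x, ‖φ x‖ₑ ^ 6 ∂cubeMeasure d ≤ C * (∫⁻ x, ‖φ x‖ₑ ^ 2 ∂cubeMeasure d) *
        (∑ i, ∫⁻ x, ‖partialDeriv φ i x‖ₑ ^ 2 ∂cubeMeasure d) ^ 2 := by
  obtain ⟨C, hC⟩ := exists_lintegral_pow_succ_le hd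
  refine ⟨36 * C ^ 2, fun φ => ?_⟩
  rw [← lintegral_enorm_fderiv_sq]
  have hfour := hC φ 1
  have hsix := hC φ 2
  norm_num at hfour hsix
  set D := ∫⁻ x, ‖fderiv ℝ φ x‖ₑ ^ 2 ∂cubeMeasure d
  set A := ∫⁻ x, ‖φ x‖ₑ ^ 2 ∂cubeMeasure d
  calc ∫⁻ x, ‖φ x‖ₑ ^ 6 ∂cubeMeasure d
      ≤ C * 9 * ((C * 4 * (A * D)) * D) := hsix.trans (by gcongr)
    _ = (36 * C ^ 2 : ℝ≥0) * A * D ^ 2 := by push_cast; ring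

end Sobolev

section Gradient

variable {d : ℕ}

lemma memLp_test (φ : CubeTest d) (p : ℝ≥0∞) : MemLp φ p (cubeMeasure d) :=
  φ.continuous.memLp_of_hasCompactSupport φ.hasCompactSupport

lemma memLp_partialDeriv (φ : CubeTest d) (i : Fin d) (p : ℝ≥0∞) :
    MemLp (partialDeriv φ i) p (cubeMeasure d) :=
  (continuous_partialDeriv φ i).memLp_of_hasCompactSupport
    (φ.hasCompactSupport.fderiv_apply (𝕜 := ℝ) (EuclideanSpace.single i 1))

lemma partialDeriv_add (φ ψ : CubeTest d) (i : Fin d) :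
    partialDeriv (φ + ψ : CubeTest d) i = partialDeriv φ i + partialDeriv ψ i := by
  ext x
  exact congrArg (· (EuclideanSpace.single i 1))
    (fderiv_add (differentiable_test φ x) (differentiable_test ψ x))

lemma partialDeriv_smul (c : ℝ) (φ : CubeTest d) (i : Fin d) :
    partialDeriv (c • φ : CubeTest d) i = c • partialDeriv φ i := by
  ext x
  exact congrArg (· (EuclideanSpace.single i 1)) (fderiv_const_smul (differentiable_test φ x) c)

/-- The map `φ ↦ (φ, ∇φ)` from test functions to `L²`; the closure of its range is the graph of
the weak gradient on `H¹₀`. -/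
noncomputable def gradientGraph (d : ℕ) : CubeTest d →ₗ[ℝ] L2 d × (Fin d → L2 d) where
  toFun φ := ((memLp_test φ 2).toLp, fun i => (memLp_partialDeriv φ i 2).toLp)
  map_add' φ ψ := by
    refine Prod.ext rfl (funext fun i => ?_)
    exact MemLp.toLp_congr (memLp_partialDeriv (φ + ψ) i 2)
      ((memLp_partialDeriv φ i 2).add (memLp_partialDeriv ψ i 2)) (by rw [partialDeriv_add])
  map_smul' c φ := by
    refine Prod.ext rfl (funext fun i => ?_)
    exact MemLp.toLp_congr (memLp_partialDeriv (c • φ) i 2)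
      ((memLp_partialDeriv φ i 2).const_smul c) (by rw [partialDeriv_smul])

lemma gradientGraph_fst (φ : CubeTest d) :
    (gradientGraph d φ).1 = (memLp_test φ 2).toLp := rfl

lemma gradientGraph_snd (φ : CubeTest d) (i : Fin d) :
    (gradientGraph d φ).2 i = (memLp_partialDeriv φ i 2).toLp := rfl

lemma hasH10Gradient_iff_exists_tendsto {w : L2 d} {g : Fin d → L2 d} :
    HasH10Gradient w g ↔
      ∃ φ : ℕ → CubeTest d, Tendsto (fun n => gradientGraph d (φ n)) atTop (𝓝 (w, g)) := by
  refine exists_congr fun φ => ?_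
  rw [Prod.tendsto_iff, tendsto_pi_nhds]
  refine and_congr ?_ (forall_congr' fun i => ?_)
  · simpa using! (Lp.tendsto_Lp_iff_tendsto_eLpNorm'' (fi := atTop) (fun n => ⇑(φ n))
      (fun n => memLp_test (φ n) 2) w (Lp.memLp w)).symm
  · simpa using! (Lp.tendsto_Lp_iff_tendsto_eLpNorm'' (fi := atTop) (fun n => partialDeriv (φ n) i)
      (fun n => memLp_partialDeriv (φ n) i 2) (g i) (Lp.memLp (g i))).symm

lemma hasH10Gradient_iff_mem_closure {w : L2 d} {g : Fin d → L2 d} :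
    HasH10Gradient w g ↔ (w, g) ∈ (LinearMap.range (gradientGraph d)).topologicalClosure := by
  rw [hasH10Gradient_iff_exists_tendsto, ← SetLike.mem_coe, Submodule.topologicalClosure_coe,
    mem_closure_iff_seq_limit]
  constructor
  · rintro ⟨φ, hφ⟩
    exact ⟨_, fun n => ⟨φ n, rfl⟩, hφ⟩
  · rintro ⟨p, hp, hlim⟩
    choose φ hφ using hp
    exact ⟨φ, by simpa only [hφ] using hlim⟩

lemma HasH10Gradient.sum_smul {ι : Type*} (s : Finset ι) {w : ι → L2 d} {g : ι → Fin d → L2 d}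
    (h : ∀ k, HasH10Gradient (w k) (g k)) (c : ι → ℝ) :
    HasH10Gradient (∑ k ∈ s, c k • w k) (∑ k ∈ s, c k • g k) := by
  have hsum := Submodule.sum_mem _ fun k (_ : k ∈ s) =>
    Submodule.smul_mem _ (c k) (hasH10Gradient_iff_mem_closure.1 (h k))
  rw [hasH10Gradient_iff_mem_closure]
  convert hsum <;> simp [Prod.fst_sum, Prod.snd_sum]

lemma inner_eq_integral (f g : L2 d) : inner ℝ f g = ∫ x, f x * g x ∂cubeMeasure d := by
  rw [L2.inner_def]
  simp [mul_comm]

lemma inner_toLp_eq_integral (f : L2 d) {g : EuclideanSpace ℝ (Fin d) → ℝ}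
    (hg : MemLp g 2 (cubeMeasure d)) : inner ℝ f hg.toLp = ∫ x, f x * g x ∂cubeMeasure d := by
  rw [inner_eq_integral]
  exact integral_congr_ae (hg.coeFn_toLp.mono fun x hx => by simp only [hx])

lemma sum_inner_gradient_eq_of_weak_eigen {μ : ℝ} {w : L2 d} {g : Fin d → L2 d}
    (heig : ∀ φ : CubeTest d,
      ∑ i, ∫ x, g i x * partialDeriv φ i x ∂cubeMeasure d = μ * ∫ x, w x * φ x ∂cubeMeasure d)
    {w' : L2 d} {g' : Fin d → L2 d} (h' : HasH10Gradient w' g') :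
    ∑ i, inner ℝ (g i) (g' i) = μ * inner ℝ w w' := by
  obtain ⟨φ, hφ⟩ := hasH10Gradient_iff_exists_tendsto.1 h'
  have hleft : Tendsto (fun n => ∑ i, inner ℝ (g i) ((gradientGraph d (φ n)).2 i)) atTop
      (𝓝 (∑ i, inner ℝ (g i) (g' i))) :=
    tendsto_finsetSum _ fun i _ => tendsto_const_nhds.inner (hφ.snd_nhds.apply_nhds i)
  have hright : Tendsto (fun n => μ * inner ℝ w (gradientGraph d (φ n)).1) atTop
      (𝓝 (μ * inner ℝ w w')) := (tendsto_const_nhds.inner hφ.fst_nhds).const_mul μ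
  refine tendsto_nhds_unique hleft (hright.congr fun n => ?_)
  simpa only [gradientGraph_fst, gradientGraph_snd, inner_toLp_eq_integral] using
    (heig (φ n)).symm

lemma eLpNorm_natCast_pow {X E : Type*} [MeasurableSpace X] [NormedAddCommGroup E]
    {n : ℕ} (hn : n ≠ 0) (μ : Measure X) (f : X → E) :
    eLpNorm f n μ ^ n = ∫⁻ x, ‖f x‖ₑ ^ n ∂μ := by
  simpa using eLpNorm_nnreal_pow_eq_lintegral (μ := μ) (f := f) (p := n) (by exact_mod_cast hn)

lemma ofReal_norm_toLp_sq {f : EuclideanSpace ℝ (Fin d) → ℝ} (hf : MemLp f 2 (cubeMeasure d)) :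
    ENNReal.ofReal (‖hf.toLp‖ ^ 2) = ∫⁻ x, ‖f x‖ₑ ^ 2 ∂cubeMeasure d := by
  rw [Lp.norm_toLp, ENNReal.ofReal_pow ENNReal.toReal_nonneg, ENNReal.ofReal_toReal hf.2.ne]
  exact_mod_cast eLpNorm_natCast_pow two_ne_zero _ f

lemma exists_eLpNorm_six_le_of_test (hd : d = 1 ∨ d = 2) :
    ∃ C : ℝ≥0, ∀ φ : CubeTest d, eLpNorm φ 6 (cubeMeasure d) ≤
      ENNReal.ofReal ((C * ‖(gradientGraph d φ).1‖ ^ 2 *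
        (∑ i, ‖(gradientGraph d φ).2 i‖ ^ 2) ^ 2) ^ (1 / 6 : ℝ)) := by
  obtain ⟨C, hC⟩ := exists_lintegral_pow_six_le_of_test hd
  refine ⟨C, fun φ => ?_⟩
  have hpow : eLpNorm φ 6 (cubeMeasure d) ^ 6 ≤ ENNReal.ofReal (C *
      ‖(gradientGraph d φ).1‖ ^ 2 * (∑ i, ‖(gradientGraph d φ).2 i‖ ^ 2) ^ 2) := by
    rw [show (6 : ℝ≥0∞) = (6 : ℕ) by norm_num, eLpNorm_natCast_pow (by norm_num),
      ENNReal.ofReal_mul (by positivity), ENNReal.ofReal_mul (by positivity),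
      ENNReal.ofReal_pow (p := ∑ i, _) (by positivity),
      ENNReal.ofReal_sum_of_nonneg fun _ _ => by positivity]
    simpa only [gradientGraph_fst, gradientGraph_snd, ofReal_norm_toLp_sq,
      ENNReal.ofReal_coe_nnreal] using hC φ
  rw [← ENNReal.ofReal_rpow_of_nonneg (by positivity) (by positivity)]
  rw [one_div, ENNReal.le_rpow_inv_iff (by norm_num)]
  exact_mod_cast hpow

lemma exists_eLpNorm_six_le (hd : d = 1 ∨ d = 2) :
    ∃ C : ℝ≥0, ∀ (w : L2 d) (g : Fin d → L2 d), HasH10Gradient w g →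
      eLpNorm w 6 (cubeMeasure d) ≤
        ENNReal.ofReal ((C * ‖w‖ ^ 2 * (∑ i, ‖g i‖ ^ 2) ^ 2) ^ (1 / 6 : ℝ)) := by
  obtain ⟨C, hC⟩ := exists_eLpNorm_six_le_of_test hd
  refine ⟨C, fun w g h => ?_⟩
  obtain ⟨φ, hφ⟩ := hasH10Gradient_iff_exists_tendsto.1 h
  have hmeas : TendstoInMeasure (cubeMeasure d) (fun n => (gradientGraph d (φ n)).1) atTop w :=
    tendstoInMeasure_of_tendsto_Lp hφ.fst_nhds
  obtain ⟨ns, hns, hae⟩ := hmeas.exists_seq_tendsto_ae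
  have hbound : Continuous fun p : L2 d × (Fin d → L2 d) =>
      ENNReal.ofReal ((C * ‖p.1‖ ^ 2 * (∑ i, ‖p.2 i‖ ^ 2) ^ 2) ^ (1 / 6 : ℝ)) :=
    ENNReal.continuous_ofReal.comp
      (Continuous.rpow_const (by fun_prop) fun _ => Or.inr (by norm_num))
  calc eLpNorm w 6 (cubeMeasure d)
      ≤ liminf (fun n => eLpNorm (gradientGraph d (φ (ns n))).1 6 (cubeMeasure d)) atTop :=
        Lp.eLpNorm_lim_le_liminf_eLpNorm (fun n => Lp.aestronglyMeasurable _) _ hae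
    _ ≤ liminf (fun n => ENNReal.ofReal ((C * ‖(gradientGraph d (φ (ns n))).1‖ ^ 2 *
          (∑ i, ‖(gradientGraph d (φ (ns n))).2 i‖ ^ 2) ^ 2) ^ (1 / 6 : ℝ))) atTop := by
        refine liminf_le_liminf (Eventually.of_forall fun n => ?_)
        exact (eLpNorm_congr_ae (memLp_test (φ (ns n)) 2).coeFn_toLp).trans_le (hC _)
    _ = ENNReal.ofReal ((C * ‖w‖ ^ 2 * (∑ i, ‖g i‖ ^ 2) ^ 2) ^ (1 / 6 : ℝ)) :=
        ((hbound.tendsto (w, g)).comp (hφ.comp hns.tendsto_atTop)).liminf_eq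

end Gradient

section Coordinates

variable {H : Type*} [NormedAddCommGroup H] [InnerProductSpace ℝ H]
  (e : HilbertBasis ℕ ℝ H) (N : ℕ)

lemma orthonormal_fin : Orthonormal ℝ fun i : Fin N => e i :=
  e.orthonormal.comp _ Fin.val_injective

/-- The isometry from coordinate vectors onto the span of the first `N` basis vectors. -/
noncomputable def embed : EuclideanSpace ℝ (Fin N) →ₗᵢ[ℝ] H where
  toFun x := ∑ i, x i • e i
  map_add' x y := by simp [add_smul, Finset.sum_add_distrib]
  map_smul' c x := by simp [mul_smul, Finset.smul_sum]
  norm_map' x := by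
    refine (sq_eq_sq₀ (norm_nonneg _) (norm_nonneg _)).1 ?_
    rw [← real_inner_self_eq_norm_sq, ← real_inner_self_eq_norm_sq, PiLp.inner_apply]
    exact (orthonormal_fin e N).inner_sum x x Finset.univ

/-- The first `N` coordinates of a vector. -/
noncomputable def coords : H →L[ℝ] EuclideanSpace ℝ (Fin N) :=
  (PiLp.continuousLinearEquiv 2 ℝ (fun _ : Fin N => ℝ)).symm.toContinuousLinearMap ∘L
    ContinuousLinearMap.pi fun i : Fin N => innerSL ℝ (e i)

/-- The diagonal operator with entries `lam 0, …, lam (N - 1)`: the operator `-Λ_N` in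
coordinates. -/
noncomputable def stiffness (lam : ℕ → ℝ) :
    EuclideanSpace ℝ (Fin N) →L[ℝ] EuclideanSpace ℝ (Fin N) :=
  Matrix.toEuclideanCLM (𝕜 := ℝ) (Matrix.diagonal fun i : Fin N => lam i)

variable {e N}

lemma embed_apply (x : EuclideanSpace ℝ (Fin N)) : embed e N x = ∑ i, x i • e i := rfl

lemma coords_apply (w : H) (i : Fin N) : coords e N w i = inner ℝ (e i) w := rfl

lemma stiffness_apply (lam : ℕ → ℝ) (x : EuclideanSpace ℝ (Fin N)) (i : Fin N) :
    stiffness N lam x i = lam i * x i := by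
  simp [stiffness, Matrix.mulVec_diagonal]

lemma coords_embed (x : EuclideanSpace ℝ (Fin N)) : coords e N (embed e N x) = x := by
  ext i
  exact (orthonormal_fin e N).inner_right_fintype x i

lemma inner_basis_embed (x : EuclideanSpace ℝ (Fin N)) (i : Fin N) :
    inner ℝ (e i) (embed e N x) = x i := by
  rw [← coords_apply, coords_embed]

lemma inner_basis_embed_of_le (x : EuclideanSpace ℝ (Fin N)) {k : ℕ} (hk : N ≤ k) :
    inner ℝ (e k) (embed e N x) = 0 := by
  rw [embed_apply, inner_sum]
  exact Finset.sum_eq_zero fun i _ => by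
    rw [inner_smul_right, e.orthonormal.inner_eq_zero (i.2.trans_le hk).ne', mul_zero]

lemma norm_coords_le (w : H) : ‖coords e N w‖ ≤ ‖w‖ := by
  refine (sq_le_sq₀ (norm_nonneg _) (norm_nonneg _)).1 ?_
  rw [EuclideanSpace.norm_sq_eq]
  exact (orthonormal_fin e N).sum_inner_products_le (s := Finset.univ) w

lemma inner_stiffness (lam : ℕ → ℝ) (x y : EuclideanSpace ℝ (Fin N)) :
    inner ℝ (stiffness N lam x) y = ∑ i : Fin N, lam i * (x i * y i) := by
  simp only [PiLp.inner_apply, stiffness_apply, RCLike.inner_apply, conj_trivial]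
  exact Finset.sum_congr rfl fun i _ => by ring

lemma inner_stiffness_comm (lam : ℕ → ℝ) (x y : EuclideanSpace ℝ (Fin N)) :
    inner ℝ (stiffness N lam x) y = inner ℝ x (stiffness N lam y) := by
  simp only [real_inner_comm _ x, inner_stiffness, mul_comm (x _)]

lemma inner_stiffness_self_nonneg {lam : ℕ → ℝ} (hlam : ∀ k, 0 ≤ lam k)
    (x : EuclideanSpace ℝ (Fin N)) : 0 ≤ inner ℝ (stiffness N lam x) x := by
  rw [inner_stiffness]
  exact Finset.sum_nonneg fun i _ => mul_nonneg (hlam i) (mul_self_nonneg _)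

end Coordinates

section GalerkinSpace

variable {d N : ℕ} {e : HilbertBasis ℕ ℝ (L2 d)}

lemma mem_galerkinSpace_iff {w : L2 d} : w ∈ galerkinSpace e N ↔ ∃ x, embed e N x = w := by
  have hrange : galerkinSpace e N = LinearMap.range (embed e N).toLinearMap := by
    refine le_antisymm (Submodule.span_le.2 ?_) ?_
    · rintro _ ⟨k, hk, rfl⟩
      exact ⟨EuclideanSpace.single ⟨k, hk⟩ 1, by simp [embed_apply, ite_smul]⟩
    · rintro _ ⟨x, rfl⟩
      have hmem : ∀ i : Fin N, e i ∈ galerkinSpace e N := fun i =>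
        Submodule.subset_span (Set.mem_image_of_mem _ i.isLt)
      change ∑ i, x i • e i ∈ galerkinSpace e N
      exact Submodule.sum_mem _ fun i _ => Submodule.smul_mem _ (x i) (hmem i)
  rw [hrange]
  rfl

lemma galerkinProj_eq (g : EuclideanSpace ℝ (Fin d) → ℝ) :
    galerkinProj e N g =
      embed e N (WithLp.toLp 2 fun i : Fin N => ∫ x, g x * e i x ∂cubeMeasure d) := by
  rw [galerkinProj, Finset.sum_range]
  rfl

lemma galerkinProj_coe (w : L2 d) : galerkinProj e N w = embed e N (coords e N w) := by
  simp only [galerkinProj_eq, ← inner_eq_integral, real_inner_comm _ w]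
  rfl

lemma galerkinLaplacian_eq (lam : ℕ → ℝ) (w : L2 d) :
    galerkinLaplacian e lam N w = -embed e N (stiffness N lam (coords e N w)) := by
  rw [galerkinLaplacian, Finset.sum_range, embed_apply]
  simp only [real_inner_comm _ w, stiffness_apply, coords_apply]

lemma hdotOneNormSq_embed (lam : ℕ → ℝ) (x : EuclideanSpace ℝ (Fin N)) :
    hdotOneNormSq e lam (embed e N x) = inner ℝ (stiffness N lam x) x := by
  rw [hdotOneNormSq, tsum_eq_sum (s := Finset.range N), Finset.sum_range, inner_stiffness]
  · simp only [real_inner_comm, inner_basis_embed, pow_two]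
  · intro k hk
    rw [real_inner_comm, inner_basis_embed_of_le _ (by simpa using hk)]
    simp

lemma inner_stiffness_coords_le {lam : ℕ → ℝ} (hlam : ∀ k, 0 ≤ lam k) {w : L2 d}
    (hw : MemHdotOne e lam w) :
    inner ℝ (stiffness N lam (coords e N w)) (coords e N w) ≤ hdotOneNormSq e lam w := by
  refine le_trans (le_of_eq ?_)
    (hw.sum_le_tsum (Finset.range N) fun k _ => mul_nonneg (hlam k) (sq_nonneg _))
  rw [inner_stiffness, Finset.sum_range]
  simp only [coords_apply, real_inner_comm, pow_two]

end GalerkinSpace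

section PointEvaluation

variable {d : ℕ} (e : HilbertBasis ℕ ℝ (L2 d)) (N : ℕ)

/-- Evaluation at `y` of the function with given coordinates, as a linear functional of the
coordinates. It uses the fixed representatives of the basis functions, so that it makes sense for
every `y` and is linear without exceptional null sets. -/
noncomputable def evalAt (y : EuclideanSpace ℝ (Fin d)) : EuclideanSpace ℝ (Fin N) →L[ℝ] ℝ :=
  ∑ i : Fin N, e i y • EuclideanSpace.proj i

variable {e N}

lemma evalAt_apply (y : EuclideanSpace ℝ (Fin d)) (x : EuclideanSpace ℝ (Fin N)) :
    evalAt e N y x = ∑ i : Fin N, x i * e i y := by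
  simp [evalAt, mul_comm]

lemma coeFn_embed (x : EuclideanSpace ℝ (Fin N)) :
    embed e N x =ᵐ[cubeMeasure d] fun y => evalAt e N y x := by
  have hsmul : ∀ᵐ y ∂cubeMeasure d, ∀ i : Fin N, (x i • e i : L2 d) y = x i * e i y :=
    ae_all_iff.2 fun i => Lp.coeFn_smul (x i) (e i)
  filter_upwards [Lp.coeFn_fun_finsetSum Finset.univ fun i : Fin N => x i • e i, hsmul]
    with y hsum hy
  rw [embed_apply, hsum, evalAt_apply]
  simp [hy]

end PointEvaluation

section Eigenbasis

variable {d : ℕ} {e : HilbertBasis ℕ ℝ (L2 d)} {lam : ℕ → ℝ}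

lemma IsDirichletEigenbasis.lam_nonneg (he : IsDirichletEigenbasis e lam) (k : ℕ) :
    0 ≤ lam k := by
  obtain ⟨g, hg, heig⟩ := he.eigen k
  have hlam := sum_inner_gradient_eq_of_weak_eigen heig hg
  simp only [real_inner_self_eq_norm_sq, e.orthonormal.1 k, one_pow, mul_one] at hlam
  exact hlam ▸ Finset.sum_nonneg fun _ _ => sq_nonneg _

lemma IsDirichletEigenbasis.exists_gradient_embed (he : IsDirichletEigenbasis e lam) {N : ℕ}
    (x : EuclideanSpace ℝ (Fin N)) :
    ∃ g : Fin d → L2 d, HasH10Gradient (embed e N x) g ∧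
      ∑ i, ‖g i‖ ^ 2 = inner ℝ (stiffness N lam x) x := by
  choose g hg heig using he.eigen
  set G : Fin d → L2 d := ∑ k : Fin N, x k • g k
  have hG : HasH10Gradient (embed e N x) G :=
    HasH10Gradient.sum_smul Finset.univ (fun k : Fin N => hg k) x
  refine ⟨G, hG, ?_⟩
  calc ∑ i, ‖G i‖ ^ 2
      = ∑ i, ∑ k : Fin N, x k * inner ℝ (g k i) (G i) := by
        refine Finset.sum_congr rfl fun i _ => ?_
        rw [← real_inner_self_eq_norm_sq]
        nth_rw 1 [show G i = ∑ k : Fin N, x k • g k i by simp [G]]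
        simp only [sum_inner, real_inner_smul_left]
    _ = ∑ k : Fin N, x k * ∑ i, inner ℝ (g k i) (G i) := by
        rw [Finset.sum_comm]
        simp only [Finset.mul_sum]
    _ = ∑ k : Fin N, x k * (lam k * x k) := by
        simp only [sum_inner_gradient_eq_of_weak_eigen (heig _) hG, inner_basis_embed]
    _ = inner ℝ (stiffness N lam x) x := by
        rw [inner_stiffness]
        exact Finset.sum_congr rfl fun k _ => by ring

lemma IsDirichletEigenbasis.memLp_six_embed (he : IsDirichletEigenbasis e lam)
    (hd : d = 1 ∨ d = 2) {N : ℕ} (x : EuclideanSpace ℝ (Fin N)) :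
    MemLp (embed e N x) 6 (cubeMeasure d) := by
  obtain ⟨C, hC⟩ := exists_eLpNorm_six_le hd
  obtain ⟨g, hg, -⟩ := he.exists_gradient_embed x
  exact ⟨Lp.aestronglyMeasurable _, (hC _ g hg).trans_lt ENNReal.ofReal_lt_top⟩

lemma IsDirichletEigenbasis.memLp_six (he : IsDirichletEigenbasis e lam)
    (hd : d = 1 ∨ d = 2) (k : ℕ) : MemLp (e k) 6 (cubeMeasure d) := by
  simpa [embed_apply, ite_smul] using
    he.memLp_six_embed hd (EuclideanSpace.single (Fin.last k) 1)

lemma IsDirichletEigenbasis.exists_normL6_pow_six_le (he : IsDirichletEigenbasis e lam)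
    (hd : d = 1 ∨ d = 2) :
    ∃ C : ℝ≥0, ∀ (N : ℕ) (x : EuclideanSpace ℝ (Fin N)),
      normL6 (embed e N x) ^ 6 ≤ C * ‖x‖ ^ 2 * inner ℝ (stiffness N lam x) x ^ 2 := by
  obtain ⟨C, hC⟩ := exists_eLpNorm_six_le hd
  refine ⟨C, fun N x => ?_⟩
  obtain ⟨g, hg, hsum⟩ := he.exists_gradient_embed x
  have hle := ENNReal.toReal_le_of_le_ofReal (by positivity) (hC _ g hg)
  rw [hsum, LinearIsometry.norm_map, one_div] at hle
  have hpow := pow_le_pow_left₀ ENNReal.toReal_nonneg hle 6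
  rwa [← Real.rpow_natCast (_ ^ _) 6, Nat.cast_ofNat, Real.rpow_inv_rpow (by positivity)
    (by norm_num)] at hpow

lemma continuous_normL6_embed {N : ℕ} (hL : ∀ x, MemLp (embed e N x) 6 (cubeMeasure d)) :
    Continuous fun x => normL6 (embed e N x) := by
  have : Fact ((1 : ℝ≥0∞) ≤ 6) := ⟨by norm_num⟩
  let L : EuclideanSpace ℝ (Fin N) →ₗ[ℝ] Lp ℝ 6 (cubeMeasure d) :=
    { toFun := fun x => (hL x).toLp
      map_add' := fun x y => MemLp.toLp_congr _ ((hL x).add (hL y)) (by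
        rw [map_add]; exact Lp.coeFn_add _ _)
      map_smul' := fun c x => MemLp.toLp_congr _ ((hL x).const_smul c) (by
        rw [map_smul]; exact Lp.coeFn_smul _ _) }
  have hnorm : ∀ x, normL6 (embed e N x) = ‖L x‖ := fun x => (Lp.norm_toLp _ (hL x)).symm
  simpa only [hnorm] using L.continuous_of_finiteDimensional.norm

end Eigenbasis

section PolynomialGrowth

variable {X V F : Type*} [NormedAddCommGroup V] [NormedSpace ℝ V] [NormedAddCommGroup F]
  {n : ℕ} {q : F → ℝ}

lemma exists_nonneg_growth_bound (hq : q =O[⊤] fun z => (1 + ‖z‖) ^ n) :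
    ∃ C, 0 ≤ C ∧ ∀ z, ‖q z‖ ≤ C * (1 + ‖z‖) ^ n := by
  obtain ⟨C, hC, hbound⟩ := hq.exists_nonneg
  refine ⟨C, hC, fun z => (Asymptotics.isBigOWith_top.1 hbound z).trans_eq ?_⟩
  rw [Real.norm_of_nonneg (by positivity)]

variable [NormedSpace ℝ F] {ev : X → V →L[ℝ] F}

lemma norm_comp_apply_le_of_growth {C R : ℝ} (hC : 0 ≤ C)
    (hq : ∀ z, ‖q z‖ ≤ C * (1 + ‖z‖) ^ n) {p : V} (hp : ‖p‖ ≤ R) (y : X) :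
    ‖q (ev y p)‖ ≤ C * (1 + R * ‖ev y‖) ^ n := by
  refine (hq _).trans ?_
  gcongr
  exact ((ev y).le_opNorm p).trans (by rw [mul_comm]; gcongr)

variable [MeasurableSpace X] {μ : Measure X} [IsFiniteMeasure μ]

lemma integrable_const_mul_one_add_mul_norm_pow {E : Type*} [NormedAddCommGroup E]
    {φ : X → E} (hn : n ≠ 0) (hφ : MemLp φ n μ)
    (C R : ℝ) : Integrable (fun y => C * (1 + R * ‖φ y‖) ^ n) μ := by
  have hadd : MemLp (fun y => 1 + R * ‖φ y‖) n μ :=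
    (memLp_const (1 : ℝ)).add (hφ.norm.const_mul R)
  refine Integrable.const_mul ((integrable_norm_iff ?_).1 ?_) C
  · exact hadd.aestronglyMeasurable.pow n
  · simpa only [norm_pow] using hadd.integrable_norm_pow hn

lemma integrable_comp_apply_of_growth (hn : n ≠ 0) (hev : MemLp ev n μ) (hqc : Continuous q)
    (hq : q =O[⊤] fun z => (1 + ‖z‖) ^ n) (p : V) : Integrable (fun y => q (ev y p)) μ := by
  obtain ⟨C, hC, hbound⟩ := exists_nonneg_growth_bound hq
  exact (integrable_const_mul_one_add_mul_norm_pow hn hev C ‖p‖).mono'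
    (hqc.comp_aestronglyMeasurable (hev.aestronglyMeasurable.apply_continuousLinearMap p))
    (Eventually.of_forall (norm_comp_apply_le_of_growth hC hbound le_rfl))

lemma continuous_integral_comp_apply_of_growth (hn : n ≠ 0) (hev : MemLp ev n μ)
    (hqc : Continuous q) (hq : q =O[⊤] fun z => (1 + ‖z‖) ^ n) :
    Continuous fun p => ∫ y, q (ev y p) ∂μ := by
  obtain ⟨C, hC, hbound⟩ := exists_nonneg_growth_bound hq
  refine continuous_iff_continuousAt.2 fun p₀ => continuousAt_of_dominated
    (Eventually.of_forall fun p => ?_) ?_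
    (integrable_const_mul_one_add_mul_norm_pow hn hev C (‖p₀‖ + 1))
    (Eventually.of_forall fun y => (hqc.comp (ev y).continuous).continuousAt)
  · exact hqc.comp_aestronglyMeasurable (hev.aestronglyMeasurable.apply_continuousLinearMap p)
  · have hnear : ∀ᶠ p in 𝓝 p₀, ‖p‖ < ‖p₀‖ + 1 :=
      continuous_norm.continuousAt.eventually_lt continuousAt_const (lt_add_one _)
    filter_upwards [hnear] with p hp
    exact Eventually.of_forall (norm_comp_apply_le_of_growth hC hbound hp.le)

end PolynomialGrowth

section

variable {X V V' F F' : Type*} [MeasurableSpace X] {μ : Measure X}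
  [NormedAddCommGroup V] [NormedSpace ℝ V] [NormedAddCommGroup V'] [NormedSpace ℝ V']
  [NormedAddCommGroup F] [NormedSpace ℝ F] [NormedAddCommGroup F'] [NormedSpace ℝ F']

lemma memLp_prodMap {p : ℝ≥0∞} {ev : X → V →L[ℝ] F} {ev' : X → V' →L[ℝ] F'}
    (hev : MemLp ev p μ) (hev' : MemLp ev' p μ) :
    MemLp (fun y => (ev y).prodMap (ev' y)) p μ := by
  have hpair : MemLp (fun y => (ev y, ev' y)) p μ := memLp_prod_iff.2 ⟨hev, hev'⟩
  exact (ContinuousLinearMap.prodMapL ℝ V F V' F').comp_memLp' hpair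

lemma memLp_evalAt {d N : ℕ} {e : HilbertBasis ℕ ℝ (L2 d)} {p : ℝ≥0∞}
    (he : ∀ k, MemLp (e k) p (cubeMeasure d)) : MemLp (evalAt e N) p (cubeMeasure d) :=
  memLp_finsetSum Finset.univ fun (i : Fin N) _ =>
    (ContinuousLinearMap.toSpanSingleton ℝ
      (EuclideanSpace.proj i : EuclideanSpace ℝ (Fin N) →L[ℝ] ℝ)).comp_memLp' (he i)

end

section SegmentMean

/-- The average of `f` over the segment from `a` to `b`. -/
noncomputable def segmentMean (f : ℝ → ℝ) (a b : ℝ) : ℝ :=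
  ∫ θ in (0 : ℝ)..1, f (a + θ * (b - a))

variable {f : ℝ → ℝ} {n : ℕ} {K : ℝ}

lemma segmentMean_mul_sub (hf : Continuous f) (a b : ℝ) :
    segmentMean f a b * (b - a) = primitive f b - primitive f a := by
  have hsub := intervalIntegral.smul_integral_comp_add_mul (a := 0) (b := 1) f (b - a) a
  simp only [mul_zero, add_zero, mul_one, add_sub_cancel, smul_eq_mul] at hsub
  rw [segmentMean, primitive, primitive, intervalIntegral.integral_interval_sub_left
    (hf.intervalIntegrable _ _) (hf.intervalIntegrable _ _), ← hsub, mul_comm]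
  simp only [mul_comm]

lemma continuous_segmentMean (hf : Continuous f) :
    Continuous fun p : ℝ × ℝ => segmentMean f p.1 p.2 :=
  intervalIntegral.continuous_parametric_intervalIntegral_of_continuous'
    (f := fun (p : ℝ × ℝ) θ => f (p.1 + θ * (p.2 - p.1))) (by fun_prop) 0 1

lemma segmentMean_isBigO (hf : f =O[⊤] fun z => (1 + ‖z‖) ^ n) :
    (fun p : ℝ × ℝ => segmentMean f p.1 p.2) =O[⊤] fun p => (1 + ‖p‖) ^ n := by
  obtain ⟨C, hC, hbound⟩ := exists_nonneg_growth_bound hf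
  refine Asymptotics.isBigO_top.2 ⟨C, fun p => ?_⟩
  rw [Real.norm_of_nonneg (show 0 ≤ (1 + ‖p‖) ^ n by positivity)]
  refine (intervalIntegral.norm_integral_le_of_norm_le_const (C := C * (1 + ‖p‖) ^ n)
    fun θ hθ => (hbound _).trans ?_).trans_eq (by simp)
  rw [Set.uIoc_of_le zero_le_one] at hθ
  have hle : ‖p.1 + θ * (p.2 - p.1)‖ ≤ ‖p‖ := by
    calc ‖p.1 + θ * (p.2 - p.1)‖ = ‖(1 - θ) * p.1 + θ * p.2‖ := by ring_nf
      _ ≤ (1 - θ) * ‖p.1‖ + θ * ‖p.2‖ := by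
        refine (norm_add_le _ _).trans_eq ?_
        rw [norm_mul, norm_mul, Real.norm_of_nonneg hθ.1.le, Real.norm_of_nonneg
          (sub_nonneg.2 hθ.2)]
      _ ≤ (1 - θ) * ‖p‖ + θ * ‖p‖ := by
        have := sub_nonneg.2 hθ.2
        have := hθ.1.le
        gcongr
        exacts [norm_fst_le p, norm_snd_le p]
      _ = ‖p‖ := by ring
  gcongr

lemma norm_primitive_le {z B : ℝ} (hB : ∀ s, ‖s‖ ≤ ‖z‖ → ‖f s‖ ≤ B) :
    ‖primitive f z‖ ≤ B * ‖z‖ := by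
  refine (intervalIntegral.norm_integral_le_of_norm_le_const fun s hs => hB s ?_).trans_eq
    (by simp)
  have hs' := Set.uIoc_subset_uIcc hs
  rcases Set.mem_uIcc.1 hs' with h | h
  · exact abs_le_abs_of_nonneg h.1 h.2
  · exact abs_le_abs_of_nonpos h.2 h.1

lemma continuous_primitive (hf : Continuous f) : Continuous (primitive f) :=
  intervalIntegral.continuous_primitive hf.intervalIntegrable 0

lemma primitive_isBigO (hf : f =O[⊤] fun z => (1 + ‖z‖) ^ n) :
    primitive f =O[⊤] fun z => (1 + ‖z‖) ^ (n + 1) := by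
  obtain ⟨C, hC, hbound⟩ := exists_nonneg_growth_bound hf
  refine Asymptotics.isBigO_top.2 ⟨C, fun z => ?_⟩
  rw [Real.norm_of_nonneg (show 0 ≤ (1 + ‖z‖) ^ (n + 1) by positivity), pow_succ, ← mul_assoc]
  refine (norm_primitive_le fun s hs => (hbound s).trans
    (show _ ≤ C * (1 + ‖z‖) ^ n by gcongr)).trans ?_
  gcongr
  simp

/-- The primitive of `b ↦ segmentMean f a b` that vanishes at `0`. -/
noncomputable def segmentMeanPrimitive (f : ℝ → ℝ) (a b : ℝ) : ℝ :=
  primitive (segmentMean f a) b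

lemma continuous_segmentMeanPrimitive (hf : Continuous f) :
    Continuous fun p : ℝ × ℝ => segmentMeanPrimitive f p.1 p.2 :=
  (intervalIntegral.continuous_parametric_primitive_of_continuous (μ := volume)
    (f := segmentMean f) (a₀ := 0) (continuous_segmentMean hf))

lemma segmentMeanPrimitive_isBigO (hf : f =O[⊤] fun z => (1 + ‖z‖) ^ n) :
    (fun p : ℝ × ℝ => segmentMeanPrimitive f p.1 p.2) =O[⊤] fun p => (1 + ‖p‖) ^ (n + 1) := by
  obtain ⟨C, hC, hbound⟩ := exists_nonneg_growth_bound (segmentMean_isBigO hf)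
  refine Asymptotics.isBigO_top.2 ⟨C, fun p => ?_⟩
  rw [Real.norm_of_nonneg (show 0 ≤ (1 + ‖p‖) ^ (n + 1) by positivity), pow_succ, ← mul_assoc]
  have hp : ‖p.2‖ ≤ 1 + ‖p‖ := (norm_snd_le p).trans (by simp)
  refine (norm_primitive_le fun s hs => (hbound (p.1, s)).trans
    (show _ ≤ C * (1 + ‖p‖) ^ n from ?_)).trans (by gcongr)
  gcongr
  exact max_le_max le_rfl hs

lemma neg_mul_sq_le_segmentMean_sub_mul (hf : Continuous f) (hK0 : 0 ≤ K)
    (hK : ∀ a b, -(K * (b - a) ^ 2) ≤ (f b - f a) * (b - a)) (a b b' : ℝ) :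
    -(K * (b' - b) ^ 2) ≤ (segmentMean f a b' - segmentMean f a b) * (b' - b) := by
  have hcont : ∀ b, Continuous fun θ => f (a + θ * (b - a)) := fun b => by fun_prop
  rw [segmentMean, segmentMean, ← intervalIntegral.integral_sub
    ((hcont b').intervalIntegrable _ _) ((hcont b).intervalIntegrable _ _),
    ← intervalIntegral.integral_mul_const]
  have hmean : -(K * (b' - b) ^ 2) = ∫ _ in (0 : ℝ)..1, -(K * (b' - b) ^ 2) := by simp
  rw [hmean]
  refine intervalIntegral.integral_mono_on_of_le_Ioo zero_le_one (by simp)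
    ((((hcont b').sub (hcont b)).mul_const _).intervalIntegrable _ _) fun θ hθ => ?_
  have hmono := hK (a + θ * (b - a)) (a + θ * (b' - a))
  have hθK : 0 ≤ K * (b' - b) ^ 2 := by positivity
  have hdiff : a + θ * (b' - a) - (a + θ * (b - a)) = θ * (b' - b) := by ring
  rw [hdiff] at hmono
  refine le_of_mul_le_mul_left ?_ hθ.1
  calc θ * -(K * (b' - b) ^ 2) ≤ -(K * (θ * (b' - b)) ^ 2) := by
        nlinarith [mul_nonneg (mul_nonneg hθ.1.le (sub_nonneg.2 hθ.2.le)) hθK]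
    _ ≤ _ := hmono.trans_eq (by ring)

lemma segmentMean_mul_sub_le (hf : Continuous f) (hK0 : 0 ≤ K)
    (hK : ∀ a b, -(K * (b - a) ^ 2) ≤ (f b - f a) * (b - a)) (a b b' : ℝ) :
    segmentMean f a b * (b' - b) - K * (b' - b) ^ 2 ≤
      segmentMeanPrimitive f a b' - segmentMeanPrimitive f a b := by
  have hcont : Continuous (segmentMean f a) :=
    (continuous_segmentMean hf).comp (by fun_prop : Continuous fun b : ℝ => (a, b))
  rw [segmentMeanPrimitive, segmentMeanPrimitive, ← segmentMean_mul_sub hcont]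
  have hmono := neg_mul_sq_le_segmentMean_sub_mul hcont hK0
    (fun s s' => neg_mul_sq_le_segmentMean_sub_mul hf hK0 hK a s s') b b b'
  have hself : segmentMean (segmentMean f a) b b = segmentMean f a b := by
    simp [segmentMean]
  rw [hself] at hmono
  linarith

end SegmentMean

section StrongConvexity

variable {E : Type*} [NormedAddCommGroup E] [InnerProductSpace ℝ E] {g : E → E} {J : E → ℝ} {μ : ℝ}

lemma hasGradientAt_of_inner_add_mul_le [CompleteSpace E] {w : E} (hg : ContinuousAt g w)
    (hJ : ∀ w w', inner ℝ (g w) (w' - w) + μ * ‖w' - w‖ ^ 2 ≤ J w' - J w) :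
    HasGradientAt J (g w) w := by
  rw [hasGradientAt_iff_isLittleO]
  have hmodulus : Tendsto (fun w' => ‖g w' - g w‖ + |μ| * ‖w' - w‖) (𝓝 w) (𝓝 0) := by
    have : ContinuousAt (fun w' => ‖g w' - g w‖ + |μ| * ‖w' - w‖) w := by fun_prop
    simpa [ContinuousAt] using this
  refine (Asymptotics.IsBigO.of_bound' (Eventually.of_forall fun w' => ?_)).trans_isLittleO
    (((Asymptotics.isLittleO_one_iff ℝ).2 hmodulus).mul_isBigO
      (Asymptotics.isBigO_refl (fun w' => ‖w' - w‖) (𝓝 w)) |>.trans_isBigO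
        (by simp [Asymptotics.isBigO_refl]))
  have hlower := hJ w w'
  have hupper := hJ w' w
  rw [norm_sub_rev w w', ← neg_sub w' w, inner_neg_right] at hupper
  have hinner : inner ℝ (g w') (w' - w) - inner ℝ (g w) (w' - w) ≤ ‖g w' - g w‖ * ‖w' - w‖ := by
    rw [← inner_sub_left]
    exact real_inner_le_norm _ _
  have hμ := neg_abs_le (μ * ‖w' - w‖ ^ 2)
  rw [abs_mul, abs_of_nonneg (sq_nonneg ‖w' - w‖)] at hμ
  rw [Real.norm_eq_abs, Real.norm_of_nonneg (by positivity), abs_le]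
  constructor <;> nlinarith [mul_nonneg (norm_nonneg (g w' - g w)) (norm_nonneg (w' - w))]

lemma existsUnique_eq_zero_of_inner_add_mul_le [ProperSpace E] (hμ : 0 < μ) (hg : Continuous g)
    (hJ : ∀ w w', inner ℝ (g w) (w' - w) + μ * ‖w' - w‖ ^ 2 ≤ J w' - J w) : ∃! w, g w = 0 := by
  have hgrad (w : E) : HasGradientAt J (g w) w :=
    hasGradientAt_of_inner_add_mul_le hg.continuousAt hJ
  have hcoercive : Tendsto J (cocompact E) atTop := by
    have hquad : Tendsto (fun r : ℝ => J 0 + r * (μ * r - ‖g 0‖)) atTop atTop :=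
      tendsto_atTop_add_const_left _ _ <| tendsto_id.atTop_mul_atTop₀ <|
        tendsto_atTop_add_const_right _ _ (tendsto_id.const_mul_atTop hμ)
    refine tendsto_atTop_mono (fun w => ?_) (hquad.comp (tendsto_norm_cocompact_atTop (E := E)))
    have hfrom0 := hJ 0 w
    rw [sub_zero] at hfrom0
    have hcs := (abs_le.1 (abs_real_inner_le_norm (g 0) w)).1
    simp only [Function.comp_apply]
    linarith
  obtain ⟨w, hw⟩ := (continuous_iff_continuousAt.2 fun w => (hgrad w).continuousAt).exists_forall_le
    hcoercive
  have hzero : g w = 0 := by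
    have hmin : IsLocalMin J w := Eventually.of_forall hw
    simpa using hmin.hasFDerivAt_eq_zero (hgrad w).hasFDerivAt
  refine ⟨w, hzero, fun w' hw' => ?_⟩
  have h₁ := hJ w w'
  have h₂ := hJ w' w
  rw [hzero, inner_zero_left] at h₁
  rw [show g w' = 0 from hw', inner_zero_left, norm_sub_rev] at h₂
  have hdist : ‖w' - w‖ ^ 2 ≤ 0 := by nlinarith
  exact sub_eq_zero.1 (norm_eq_zero.1 (pow_eq_zero_iff two_ne_zero |>.1
    (hdist.antisymm (sq_nonneg _))))

end StrongConvexity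

lemma continuous_of_isClosed_graph_of_norm_le {X Y : Type*} [TopologicalSpace X]
    [NormedAddCommGroup Y] [ProperSpace Y] {f : X → Y} (hf : IsClosed {z : X × Y | f z.1 = z.2})
    {B : X → ℝ} (hB : Continuous B) (hfB : ∀ x, ‖f x‖ ≤ B x) : Continuous f := by
  refine continuous_iff_continuousAt.2 fun x =>
    (isCompact_closedBall (0 : Y) (B x + 1)).tendsto_nhds_of_unique_mapClusterPt ?_ fun y _ hy => ?_
  · filter_upwards [hB.continuousAt.eventually_lt continuousAt_const (lt_add_one (B x))]
      with x' hx'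
    simpa using (hfB x').trans hx'.le
  · have hmem : (x, y) ∈ closure {z : X × Y | f z.1 = z.2} := by
      refine mem_closure_iff_nhds.2 fun t ht => ?_
      obtain ⟨U, hU, V, hV, hUV⟩ := mem_nhds_prod_iff.1 ht
      obtain ⟨x', hx'V, hx'U⟩ := ((mapClusterPt_iff_frequently.1 hy V hV).and_eventually hU).exists
      exact ⟨(x', f x'), hUV ⟨hx'U, hx'V⟩, rfl⟩
    exact (hf.closure_subset hmem).symm

section DiscreteGradient

variable {E : Type*} [NormedAddCommGroup E] [InnerProductSpace ℝ E]

/-- `G` is a discrete gradient of the potential `U`: the chain rule for `U` holds exactly along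
segments. -/
def IsDiscreteGradient (U : E → ℝ) (G : E → E → E) : Prop :=
  ∀ x x', inner ℝ (G x x') (x' - x) = U x' - U x

/-- One implicit step of size `h`, from `p = (x, v)` to `q = (x', v')`, of the discrete gradient
method for the Hamiltonian system `x'' = -∇U x`. -/
structure DiscreteGradientStep (G : E → E → E) (h : ℝ) (p q : E × E) : Prop where
  position : q.1 = p.1 + (h / 2) • (q.2 + p.2)
  velocity : q.2 = p.2 - h • G p.1 q.1

variable {U : E → ℝ} {G : E → E → E} {h : ℝ} {p q : E × E}

lemma DiscreteGradientStep.energy_eq (hUG : IsDiscreteGradient U G)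
    (hs : DiscreteGradientStep G h p q) :
    U q.1 + 1 / 2 * ‖q.2‖ ^ 2 = U p.1 + 1 / 2 * ‖p.2‖ ^ 2 := by
  have hU : U q.1 - U p.1 = h / 2 * inner ℝ (G p.1 q.1) (q.2 + p.2) := by
    rw [← hUG, ← inner_smul_right, ← sub_eq_iff_eq_add'.2 hs.position]
  have hkin : ‖q.2‖ ^ 2 - ‖p.2‖ ^ 2 = -(h * inner ℝ (G p.1 q.1) (q.2 + p.2)) := by
    rw [← real_inner_smul_left, ← inner_neg_left, ← sub_eq_iff_eq_add'.2
      (hs.velocity.trans (sub_eq_add_neg _ _)), inner_sub_left, inner_add_right, inner_add_right,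
      real_inner_self_eq_norm_sq, real_inner_self_eq_norm_sq, real_inner_comm p.2 q.2]
    ring
  linarith

lemma discreteGradientStep_iff :
    DiscreteGradientStep G h p q ↔
      q.1 - (p.1 + h • p.2) + (h ^ 2 / 2) • G p.1 q.1 = 0 ∧ q.2 = p.2 - h • G p.1 q.1 := by
  refine ⟨fun hs => ⟨?_, hs.velocity⟩, fun hq => ⟨?_, hq.2⟩⟩
  · nth_rw 1 [hs.position, hs.velocity]
    module
  · rw [hq.2, ← sub_eq_zero, ← hq.1]
    module

lemma existsUnique_discreteGradientStep [ProperSpace E] {Ψ : E → ℝ} {L : ℝ}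
    (hG : Continuous (G p.1))
    (hΨ : ∀ w w', inner ℝ (G p.1 w) (w' - w) - L * ‖w' - w‖ ^ 2 ≤ Ψ w' - Ψ w)
    (hL : h ^ 2 * L < 1) : ∃! q, DiscreteGradientStep G h p q := by
  have hconvex (w w' : E) : inner ℝ (w - (p.1 + h • p.2) + (h ^ 2 / 2) • G p.1 w) (w' - w)
      + (1 - h ^ 2 * L) / 2 * ‖w' - w‖ ^ 2
      ≤ (1 / 2 * ‖w' - (p.1 + h • p.2)‖ ^ 2 + h ^ 2 / 2 * Ψ w')
        - (1 / 2 * ‖w - (p.1 + h • p.2)‖ ^ 2 + h ^ 2 / 2 * Ψ w) := by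
    have hsq : ‖w' - (p.1 + h • p.2)‖ ^ 2 = ‖w - (p.1 + h • p.2)‖ ^ 2
        + 2 * inner ℝ (w - (p.1 + h • p.2)) (w' - w) + ‖w' - w‖ ^ 2 := by
      rw [← norm_add_sq_real, sub_add_sub_cancel']
    have hscaled := mul_le_mul_of_nonneg_left (hΨ w w') (show 0 ≤ h ^ 2 / 2 by positivity)
    rw [inner_add_left, real_inner_smul_left]
    linarith
  obtain ⟨x, hx, hxuniq⟩ := existsUnique_eq_zero_of_inner_add_mul_le (by linarith)
    (by fun_prop : Continuous fun w => w - (p.1 + h • p.2) + (h ^ 2 / 2) • G p.1 w)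
    (J := fun w => 1 / 2 * ‖w - (p.1 + h • p.2)‖ ^ 2 + h ^ 2 / 2 * Ψ w) hconvex
  refine ⟨(x, p.2 - h • G p.1 x), discreteGradientStep_iff.2 ⟨hx, rfl⟩, fun q hq => ?_⟩
  obtain ⟨hq₁, hq₂⟩ := discreteGradientStep_iff.1 hq
  have hqx : q.1 = x := hxuniq _ hq₁
  exact Prod.ext hqx (hqx ▸ hq₂)

lemma DiscreteGradientStep.norm_le (hUG : IsDiscreteGradient U G) (hU : ∀ x, 0 ≤ U x) (hh : 0 ≤ h)
    (hs : DiscreteGradientStep G h p q) :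
    ‖q‖ ≤ ‖p.1‖ + h / 2 * (√(2 * (U p.1 + 1 / 2 * ‖p.2‖ ^ 2)) + ‖p.2‖)
      + √(2 * (U p.1 + 1 / 2 * ‖p.2‖ ^ 2)) := by
  set r := √(2 * (U p.1 + 1 / 2 * ‖p.2‖ ^ 2))
  have hvel : ‖q.2‖ ≤ r := Real.le_sqrt_of_sq_le (by linarith [hs.energy_eq hUG, hU q.1])
  have hpos : ‖q.1‖ ≤ ‖p.1‖ + h / 2 * (r + ‖p.2‖) := by
    rw [hs.position]
    refine (norm_add_le _ _).trans ?_
    rw [norm_smul, Real.norm_of_nonneg (by positivity)]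
    gcongr
    exact (norm_add_le _ _).trans (by gcongr)
  exact norm_prod_le_iff.2 ⟨hpos.trans (le_add_of_nonneg_right (Real.sqrt_nonneg _)),
    hvel.trans (le_add_of_nonneg_left (by positivity))⟩

lemma isClosed_discreteGradientStep (hG : Continuous fun p : E × E => G p.1 p.2) :
    IsClosed {z : (E × E) × (E × E) | DiscreteGradientStep G h z.1 z.2} := by
  have : Continuous fun z : (E × E) × (E × E) => G z.1.1 z.2.1 :=
    hG.comp (f := fun z : (E × E) × (E × E) => (z.1.1, z.2.1)) (by fun_prop)
  simp only [discreteGradientStep_iff, Set.ofPred_and]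
  exact (isClosed_eq (by fun_prop) continuous_const).inter (isClosed_eq (by fun_prop) (by fun_prop))

lemma exists_continuous_discreteGradientStep [ProperSpace E] (hUG : IsDiscreteGradient U G)
    (hU : ∀ x, 0 ≤ U x) (hUc : Continuous U) (hG : Continuous fun p : E × E => G p.1 p.2)
    (hh : 0 ≤ h) (hex : ∀ p, ∃! q, DiscreteGradientStep G h p q) :
    ∃ step : E × E → E × E,
      Continuous step ∧ ∀ p q, DiscreteGradientStep G h p q ↔ step p = q := by
  choose step hstep huniq using hex
  have hiff (p q) : DiscreteGradientStep G h p q ↔ step p = q :=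
    ⟨fun hq => (huniq p q hq).symm, fun hq => hq ▸ hstep p⟩
  refine ⟨step, continuous_of_isClosed_graph_of_norm_le ?_ ?_ fun p => (hstep p).norm_le hUG hU hh,
    hiff⟩
  · simpa only [hiff] using isClosed_discreteGradientStep (h := h) hG
  · fun_prop

end DiscreteGradient

section AveragedForce

variable {d N n : ℕ} {e : HilbertBasis ℕ ℝ (L2 d)} {f : ℝ → ℝ}

/-- The nonlinearity of the averaged vector field method in coordinates: the `L²` products with the
basis functions of the average of `f` over the segment between the functions with coordinates `x`
and `x'`. -/
noncomputable def avgForce (e : HilbertBasis ℕ ℝ (L2 d)) (f : ℝ → ℝ) (N : ℕ)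
    (x x' : EuclideanSpace ℝ (Fin N)) : EuclideanSpace ℝ (Fin N) :=
  WithLp.toLp 2 fun i =>
    ∫ y, segmentMean f (evalAt e N y x) (evalAt e N y x') * e i y ∂cubeMeasure d

lemma evalAt_single (y : EuclideanSpace ℝ (Fin d)) (i : Fin N) :
    evalAt e N y (EuclideanSpace.single i 1) = e i y := by
  simp [evalAt_apply]

lemma galerkinProj_segmentMean (x x' : EuclideanSpace ℝ (Fin N)) :
    galerkinProj e N (fun y => segmentMean f (embed e N x y) (embed e N x' y)) =
      embed e N (avgForce e f N x x') := by
  rw [galerkinProj_eq]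
  congr 2
  ext i
  refine integral_congr_ae ?_
  filter_upwards [coeFn_embed (e := e) x, coeFn_embed (e := e) x'] with y hx hx'
  rw [hx, hx']

lemma integral_evalAt_sq (x : EuclideanSpace ℝ (Fin N)) :
    ∫ y, evalAt e N y x ^ 2 ∂cubeMeasure d = ‖x‖ ^ 2 := by
  rw [← (embed e N).norm_map x, ← real_inner_self_eq_norm_sq, inner_eq_integral]
  refine integral_congr_ae ?_
  filter_upwards [coeFn_embed (e := e) x] with y hx
  rw [hx, pow_two]

lemma integrable_evalAt_sq (x : EuclideanSpace ℝ (Fin N)) :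
    Integrable (fun y => evalAt e N y x ^ 2) (cubeMeasure d) :=
  ((memLp_congr_ae (coeFn_embed x)).1 (Lp.memLp (embed e N x))).integrable_sq

lemma segmentMean_mul_isBigO (hfn : f =O[⊤] fun z => (1 + ‖z‖) ^ n) :
    (fun p : ℝ × ℝ × ℝ => segmentMean f p.1 p.2.1 * p.2.2) =O[⊤]
      fun p => (1 + ‖p‖) ^ (n + 1) := by
  obtain ⟨C, hC, hbound⟩ := exists_nonneg_growth_bound (segmentMean_isBigO hfn)
  refine Asymptotics.isBigO_top.2 ⟨C, fun p => ?_⟩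
  have hfst : ‖(p.1, p.2.1)‖ ≤ ‖p‖ :=
    max_le (norm_fst_le p) ((norm_fst_le p.2).trans (norm_snd_le p))
  have hsnd : ‖p.2.2‖ ≤ 1 + ‖p‖ := by
    linarith [(norm_snd_le p.2).trans (norm_snd_le p)]
  rw [Real.norm_of_nonneg (show 0 ≤ (1 + ‖p‖) ^ (n + 1) by positivity), pow_succ, ← mul_assoc,
    norm_mul]
  gcongr
  exact (hbound (p.1, p.2.1)).trans (by gcongr)

variable (hf : Continuous f) (hfn : f =O[⊤] fun z => (1 + ‖z‖) ^ n)
  (he : ∀ k, MemLp (e k) ((n + 1 : ℕ) : ℝ≥0∞) (cubeMeasure d))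

include hf hfn he

lemma integrable_segmentMean_mul (x x' z : EuclideanSpace ℝ (Fin N)) :
    Integrable (fun y => segmentMean f (evalAt e N y x) (evalAt e N y x') * evalAt e N y z)
      (cubeMeasure d) := by
  have hev := memLp_evalAt (N := N) he
  have hcont := continuous_segmentMean hf
  exact integrable_comp_apply_of_growth n.succ_ne_zero (memLp_prodMap hev (memLp_prodMap hev hev))
    (q := fun p : ℝ × ℝ × ℝ => segmentMean f p.1 p.2.1 * p.2.2) (by fun_prop)
    (segmentMean_mul_isBigO hfn) (x, x', z)

lemma inner_avgForce (x x' z : EuclideanSpace ℝ (Fin N)) :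
    inner ℝ (avgForce e f N x x') z =
      ∫ y, segmentMean f (evalAt e N y x) (evalAt e N y x') * evalAt e N y z ∂cubeMeasure d := by
  have hint (i : Fin N) := (integrable_segmentMean_mul hf hfn he x x'
    (EuclideanSpace.single i 1)).const_mul (z i)
  simp only [evalAt_single] at hint
  calc inner ℝ (avgForce e f N x x') z
      = ∑ i, ∫ y, z i * (segmentMean f (evalAt e N y x) (evalAt e N y x') * e i y)
          ∂cubeMeasure d := by
        simp only [PiLp.inner_apply, integral_const_mul]
        rfl
    _ = _ := by
        rw [← integral_finsetSum _ fun i _ => hint i]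
        simp only [evalAt_apply _ z, Finset.mul_sum, mul_left_comm]

lemma continuous_avgForce :
    Continuous fun p : EuclideanSpace ℝ (Fin N) × EuclideanSpace ℝ (Fin N) =>
      avgForce e f N p.1 p.2 := by
  refine (PiLp.continuous_toLp 2 _).comp (continuous_pi fun i => ?_)
  have hev := memLp_evalAt (N := N) he
  have hcont := continuous_segmentMean hf
  have hint := continuous_integral_comp_apply_of_growth n.succ_ne_zero
    (memLp_prodMap hev (memLp_prodMap hev hev))
    (q := fun p : ℝ × ℝ × ℝ => segmentMean f p.1 p.2.1 * p.2.2) (by fun_prop)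
    (segmentMean_mul_isBigO hfn)
  have hslice : Continuous fun p : EuclideanSpace ℝ (Fin N) × EuclideanSpace ℝ (Fin N) =>
      (p.1, p.2, (EuclideanSpace.single i 1 : EuclideanSpace ℝ (Fin N))) := by fun_prop
  simpa [Function.comp_def, evalAt_single] using hint.comp hslice

end AveragedForce

section Potential

variable {d N n : ℕ} {e : HilbertBasis ℕ ℝ (L2 d)} {lam : ℕ → ℝ} {f : ℝ → ℝ} {C₁ : ℝ}

/-- The potential part of the energy in coordinates. -/
noncomputable def potential (e : HilbertBasis ℕ ℝ (L2 d)) (lam : ℕ → ℝ) (f : ℝ → ℝ) (C₁ : ℝ)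
    (N : ℕ) (x : EuclideanSpace ℝ (Fin N)) : ℝ :=
  1 / 2 * inner ℝ (stiffness N lam x) x + (∫ y, primitive f (evalAt e N y x) ∂cubeMeasure d) + C₁

/-- The discrete gradient of `potential` that underlies the averaged vector field method. -/
noncomputable def avfGradient (e : HilbertBasis ℕ ℝ (L2 d)) (lam : ℕ → ℝ) (f : ℝ → ℝ) (N : ℕ)
    (x x' : EuclideanSpace ℝ (Fin N)) : EuclideanSpace ℝ (Fin N) :=
  (1 / 2 : ℝ) • stiffness N lam (x' + x) + avgForce e f N x x'

lemma energy_embed (x v : EuclideanSpace ℝ (Fin N)) :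
    energy e lam f C₁ (embed e N x) (embed e N v) = potential e lam f C₁ N x + 1 / 2 * ‖v‖ ^ 2 := by
  have hint : ∫ y, primitive f (embed e N x y) ∂cubeMeasure d =
      ∫ y, primitive f (evalAt e N y x) ∂cubeMeasure d := by
    refine integral_congr_ae ?_
    filter_upwards [coeFn_embed (e := e) x] with y hy
    rw [hy]
  rw [energy, potential, hint, LinearIsometry.norm_map, hdotOneNormSq_embed]
  ring

variable (hf : Continuous f) (hfn : f =O[⊤] fun z => (1 + ‖z‖) ^ n)
  (he : ∀ k, MemLp (e k) ((n + 1 : ℕ) : ℝ≥0∞) (cubeMeasure d))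

include hf hfn he

lemma integrable_primitive_evalAt (x : EuclideanSpace ℝ (Fin N)) :
    Integrable (fun y => primitive f (evalAt e N y x)) (cubeMeasure d) :=
  integrable_comp_apply_of_growth n.succ_ne_zero (memLp_evalAt he) (continuous_primitive hf)
    (primitive_isBigO hfn) x

lemma continuous_potential : Continuous (potential e lam f C₁ N) := by
  have hint := continuous_integral_comp_apply_of_growth n.succ_ne_zero (memLp_evalAt (N := N) he)
    (continuous_primitive hf) (primitive_isBigO hfn)
  unfold potential
  fun_prop

lemma potential_nonneg (hlam : ∀ k, 0 ≤ lam k) (hC₁ : ∀ z, 0 ≤ primitive f z + C₁)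
    (x : EuclideanSpace ℝ (Fin N)) : 0 ≤ potential e lam f C₁ N x := by
  have hstiff := inner_stiffness_self_nonneg hlam x
  have hint : 0 ≤ ∫ y, (primitive f (evalAt e N y x) + C₁) ∂cubeMeasure d :=
    integral_nonneg fun y => hC₁ _
  rw [integral_add (integrable_primitive_evalAt hf hfn he x) (integrable_const _),
    integral_const, probReal_univ, one_smul] at hint
  rw [potential]
  linarith

lemma isDiscreteGradient_avfGradient :
    IsDiscreteGradient (potential e lam f C₁ N) (avfGradient e lam f N) := by
  intro x x'
  have hforce : inner ℝ (avgForce e f N x x') (x' - x) =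
      (∫ y, primitive f (evalAt e N y x') ∂cubeMeasure d)
        - ∫ y, primitive f (evalAt e N y x) ∂cubeMeasure d := by
    rw [inner_avgForce hf hfn he, ← integral_sub (integrable_primitive_evalAt hf hfn he x')
      (integrable_primitive_evalAt hf hfn he x)]
    simp only [map_sub, segmentMean_mul_sub hf]
  have hstiff : inner ℝ (stiffness N lam (x' + x)) (x' - x) =
      inner ℝ (stiffness N lam x') x' - inner ℝ (stiffness N lam x) x := by
    rw [map_add, inner_add_left, inner_sub_right, inner_sub_right, inner_stiffness_comm lam x x',
      real_inner_comm x]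
    ring
  rw [avfGradient, inner_add_left, real_inner_smul_left, hforce, hstiff, potential, potential]
  ring

lemma continuous_avfGradient :
    Continuous fun p : EuclideanSpace ℝ (Fin N) × EuclideanSpace ℝ (Fin N) =>
      avfGradient e lam f N p.1 p.2 := by
  have hforce := continuous_avgForce (N := N) hf hfn he
  unfold avfGradient
  fun_prop

end Potential

section AVFStep

variable {d N n : ℕ} {e : HilbertBasis ℕ ℝ (L2 d)} {lam : ℕ → ℝ} {f : ℝ → ℝ} {h : ℝ}

lemma avfStep_embed_iff {p q : EuclideanSpace ℝ (Fin N) × EuclideanSpace ℝ (Fin N)} :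
    AVFStep e lam f N h (embed e N p.1) (embed e N p.2) (embed e N q.1) (embed e N q.2) ↔
      DiscreteGradientStep (avfGradient e lam f N) h p q := by
  have hposition : embed e N p.1 + h • ((1 / 2 : ℝ) • (embed e N q.2 + embed e N p.2)) =
      embed e N (p.1 + (h / 2) • (q.2 + p.2)) := by
    simp only [map_add, map_smul]
    module
  have hvelocity : embed e N p.2
      + h • galerkinLaplacian e lam N ((1 / 2 : ℝ) • (embed e N q.1 + embed e N p.1))
      - h • galerkinProj e N (fun y => segmentMean f (embed e N p.1 y) (embed e N q.1 y)) =
      embed e N (p.2 - h • avfGradient e lam f N p.1 q.1) := by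
    rw [galerkinProj_segmentMean, ← map_add, ← map_smul, galerkinLaplacian_eq, coords_embed,
      avfGradient]
    simp only [map_add, map_smul, map_sub]
    module
  exact ⟨fun hs => ⟨(embed e N).injective (hs.position.trans hposition),
    (embed e N).injective (hs.velocity.trans hvelocity)⟩,
    fun hs => ⟨(congrArg _ hs.position).trans hposition.symm,
      (congrArg _ hs.velocity).trans hvelocity.symm⟩⟩

lemma AVFStep.exists_embed {x v : EuclideanSpace ℝ (Fin N)} {u' v' : L2 d}
    (hs : AVFStep e lam f N h (embed e N x) (embed e N v) u' v') :
    ∃ q : EuclideanSpace ℝ (Fin N) × EuclideanSpace ℝ (Fin N),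
      u' = embed e N q.1 ∧ v' = embed e N q.2 := by
  obtain ⟨w, rfl⟩ : ∃ w, v' = embed e N w := by
    have hvelocity := hs.velocity
    rw [galerkinLaplacian_eq, galerkinProj_eq, ← map_neg, ← map_smul, ← map_smul, ← map_add,
      ← map_sub] at hvelocity
    exact ⟨_, hvelocity⟩
  refine ⟨(x + h • ((1 / 2 : ℝ) • (w + v)), w), ?_, rfl⟩
  rw [hs.position]
  simp only [map_add, map_smul]

end AVFStep

section Solvability

variable {d N n : ℕ} {e : HilbertBasis ℕ ℝ (L2 d)} {lam : ℕ → ℝ} {f : ℝ → ℝ} {K h : ℝ}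

lemma stiffness_mul_sub_le (hlam : ∀ k, 0 ≤ lam k) (x w w' : EuclideanSpace ℝ (Fin N)) :
    inner ℝ ((1 / 2 : ℝ) • stiffness N lam (w + x)) (w' - w) ≤
      1 / 2 * inner ℝ (stiffness N lam x) (w' - w)
        + 1 / 4 * (inner ℝ (stiffness N lam w') w' - inner ℝ (stiffness N lam w) w) := by
  have hpos := inner_stiffness_self_nonneg hlam (w' - w)
  have hsymm : inner ℝ (stiffness N lam w') w = inner ℝ (stiffness N lam w) w' := by
    rw [inner_stiffness_comm, real_inner_comm]
  simp only [map_sub, map_add, inner_sub_left, inner_sub_right, inner_add_left,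
    real_inner_smul_left] at hpos ⊢
  linarith

variable (hf : Continuous f) (hfn : f =O[⊤] fun z => (1 + ‖z‖) ^ n)
  (he : ∀ k, MemLp (e k) ((n + 1 : ℕ) : ℝ≥0∞) (cubeMeasure d)) (hK0 : 0 ≤ K)
  (hK : ∀ a b, -(K * (b - a) ^ 2) ≤ (f b - f a) * (b - a))

include hf hfn he hK0 hK

lemma inner_avgForce_sub_le (x w w' : EuclideanSpace ℝ (Fin N)) :
    inner ℝ (avgForce e f N x w) (w' - w) - K * ‖w' - w‖ ^ 2 ≤
      (∫ y, segmentMeanPrimitive f (evalAt e N y x) (evalAt e N y w') ∂cubeMeasure d)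
        - ∫ y, segmentMeanPrimitive f (evalAt e N y x) (evalAt e N y w) ∂cubeMeasure d := by
  have hint (z : EuclideanSpace ℝ (Fin N)) : Integrable
      (fun y => segmentMeanPrimitive f (evalAt e N y x) (evalAt e N y z)) (cubeMeasure d) :=
    integrable_comp_apply_of_growth n.succ_ne_zero
      (memLp_prodMap (memLp_evalAt he) (memLp_evalAt he)) (continuous_segmentMeanPrimitive hf)
      (segmentMeanPrimitive_isBigO hfn) (x, z)
  rw [inner_avgForce hf hfn he, ← integral_evalAt_sq (e := e), ← integral_const_mul,
    ← integral_sub (integrable_segmentMean_mul hf hfn he x w (w' - w))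
      ((integrable_evalAt_sq _).const_mul K), ← integral_sub (hint w') (hint w)]
  refine integral_mono ((integrable_segmentMean_mul hf hfn he x w (w' - w)).sub
      ((integrable_evalAt_sq _).const_mul K)) ((hint w').sub (hint w)) fun y => ?_
  simpa only [map_sub] using segmentMean_mul_sub_le hf hK0 hK _ _ _

lemma existsUnique_avfGradient_step (hlam : ∀ k, 0 ≤ lam k) (hh : h ^ 2 * K < 1)
    (p : EuclideanSpace ℝ (Fin N) × EuclideanSpace ℝ (Fin N)) :
    ∃! q, DiscreteGradientStep (avfGradient e lam f N) h p q := by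
  have hcont : Continuous (avfGradient e lam f N p.1) :=
    (continuous_avfGradient hf hfn he).comp (g := fun p => avfGradient e lam f N p.1 p.2)
      (f := fun w => (p.1, w)) (by fun_prop)
  refine existsUnique_discreteGradientStep (L := K)
    (Ψ := fun w => 1 / 2 * inner ℝ (stiffness N lam p.1) w + 1 / 4 * inner ℝ (stiffness N lam w) w
      + ∫ y, segmentMeanPrimitive f (evalAt e N y p.1) (evalAt e N y w) ∂cubeMeasure d)
    hcont (fun w w' => ?_) hh
  have hstiff := stiffness_mul_sub_le hlam p.1 w w'
  have hforce := inner_avgForce_sub_le hf hfn he hK0 hK p.1 w w'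
  rw [inner_sub_right (stiffness N lam p.1)] at hstiff
  rw [avfGradient, inner_add_left]
  linarith

theorem stepSizeAdmissible_of_sq_mul_lt (hlam : ∀ k, 0 ≤ lam k) {h₀ : ℝ} (hh₀ : h₀ ^ 2 * K < 1) :
    StepSizeAdmissible e lam f h₀ := by
  intro N _ h hh hle u hu v hv
  obtain ⟨x, rfl⟩ := mem_galerkinSpace_iff.1 hu
  obtain ⟨w, rfl⟩ := mem_galerkinSpace_iff.1 hv
  have hhK : h ^ 2 * K < 1 := lt_of_le_of_lt (by gcongr) hh₀
  obtain ⟨q, hq, huniq⟩ := existsUnique_avfGradient_step hf hfn he hK0 hK hlam hhK (x, w)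
  refine ⟨(embed e N q.1, embed e N q.2), avfStep_embed_iff (p := (x, w)).2 hq, ?_⟩
  rintro ⟨u', v'⟩ hs
  obtain ⟨q', rfl, rfl⟩ := hs.exists_embed
  rw [huniq q' (avfStep_embed_iff.1 hs)]

end Solvability

lemma StepSizeAdmissible.existsUnique_avfGradient_step {d N : ℕ} {e : HilbertBasis ℕ ℝ (L2 d)}
    {lam : ℕ → ℝ} {f : ℝ → ℝ} {h₀ h : ℝ} (hadm : StepSizeAdmissible e lam f h₀) (hN : 1 ≤ N)
    (hh : 0 < h) (hle : h ≤ h₀) (p : EuclideanSpace ℝ (Fin N) × EuclideanSpace ℝ (Fin N)) :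
    ∃! q, DiscreteGradientStep (avfGradient e lam f N) h p q := by
  obtain ⟨⟨u', v'⟩, hs, huniq⟩ := hadm N hN h hh hle (embed e N p.1)
    (mem_galerkinSpace_iff.2 ⟨p.1, rfl⟩) (embed e N p.2) (mem_galerkinSpace_iff.2 ⟨p.2, rfl⟩)
  obtain ⟨q, rfl, rfl⟩ := hs.exists_embed
  refine ⟨q, avfStep_embed_iff.1 hs, fun q' hq' => ?_⟩
  have heq := huniq (embed e N q'.1, embed e N q'.2) (avfStep_embed_iff.2 hq')
  exact Prod.ext ((embed e N).injective (congrArg Prod.fst heq))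
    ((embed e N).injective (congrArg Prod.snd heq))

section Discretization

variable {d N n M : ℕ} {e : HilbertBasis ℕ ℝ (L2 d)} {lam : ℕ → ℝ} {f : ℝ → ℝ} {u₀ v₀ : L2 d}
  {Q S : L2 d →L[ℝ] L2 d}

lemma opTrace_eq_tsum (hS : S.IsPositive) (hSQ : S ∘L S = Q) :
    opTrace e Q = ∑' k, ‖S (e k)‖ ^ 2 := by
  refine tsum_congr fun k => ?_
  rw [← hSQ, ContinuousLinearMap.comp_apply, hS.isSelfAdjoint.isSymmetric.apply_clm,
    real_inner_self_eq_norm_sq]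

lemma opTrace_nonneg (hS : S.IsPositive) (hSQ : S ∘L S = Q) : 0 ≤ opTrace e Q :=
  (opTrace_eq_tsum hS hSQ).symm ▸ tsum_nonneg fun _ => sq_nonneg _

lemma sum_norm_coords_sq_le (hS : S.IsPositive) (hHS : Summable fun k => ‖S (e k)‖ ^ 2)
    (b : HilbertBasis ℕ ℝ (L2 d)) (K : ℕ) :
    ∑ k ∈ Finset.range K, ‖coords e N (S (b k))‖ ^ 2 ≤ ∑' k, ‖S (e k)‖ ^ 2 := by
  calc ∑ k ∈ Finset.range K, ‖coords e N (S (b k))‖ ^ 2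
      = ∑ i : Fin N, ∑ k ∈ Finset.range K, ‖inner ℝ (b k) (S (e i))‖ ^ 2 := by
        rw [Finset.sum_comm]
        refine Finset.sum_congr rfl fun k _ => ?_
        rw [EuclideanSpace.norm_sq_eq]
        refine Finset.sum_congr rfl fun i _ => ?_
        rw [coords_apply, ← hS.isSelfAdjoint.isSymmetric.apply_clm, real_inner_comm]
    _ ≤ ∑ i : Fin N, ‖S (e i)‖ ^ 2 :=
        Finset.sum_le_sum fun i _ => b.orthonormal.sum_inner_products_le _
    _ = ∑ k ∈ Finset.range N, ‖S (e k)‖ ^ 2 := (Finset.sum_range fun k => ‖S (e k)‖ ^ 2).symm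
    _ ≤ _ := hHS.sum_le_tsum _ fun _ _ => by positivity

variable {Ω : Type*} [MeasurableSpace Ω] {P : Measure Ω} {W : ℝ≥0 → Ω → L2 d} {h : ℝ}
  {u v vbar : ℕ → Ω → L2 d}

lemma IsFullDiscretization.ae_eq_trajectory
    (hdisc : IsFullDiscretization e lam f u₀ v₀ P W N M h u v vbar)
    {step : EuclideanSpace ℝ (Fin N) × EuclideanSpace ℝ (Fin N) →
      EuclideanSpace ℝ (Fin N) × EuclideanSpace ℝ (Fin N)}
    (hstep : ∀ p q, DiscreteGradientStep (avfGradient e lam f N) h p q ↔ step p = q)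
    {m : ℕ} (hm : m ≤ M) :
    ∀ᵐ ω ∂P, (u m ω, v m ω) = Prod.map (embed e N) (embed e N)
      (trajectory step (coords e N u₀, coords e N v₀)
        (fun j => coords e N (W (gridTime h (j + 1)) ω - W (gridTime h j) ω)) m) := by
  induction m with
  | zero =>
    filter_upwards [hdisc.init_u, hdisc.init_v] with ω hu hv
    rw [hu, hv, galerkinProj_coe, galerkinProj_coe]
    rfl
  | succ m ih =>
    filter_upwards [ih (by omega), hdisc.step m (by omega), hdisc.noise m (by omega)]
      with ω hcur hs hnoise
    obtain ⟨hu, hv⟩ := Prod.ext_iff.1 hcur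
    simp only [Prod.map_fst, Prod.map_snd] at hu hv
    rw [hu, hv] at hs
    obtain ⟨q, hqu, hqv⟩ := hs.exists_embed
    rw [hqu, hqv, avfStep_embed_iff, hstep] at hs
    rw [hnoise, hqu, hqv, galerkinProj_coe, ← map_add, trajectory, hs, Prod.map_apply]

lemma integrable_and_integral_le_of_lintegral_le {F G : Ω → ℝ} (hFG : F =ᵐ[P] G)
    (hG : AEMeasurable G P) (hG0 : ∀ ω, 0 ≤ G ω) {B : ℝ} (hB : 0 ≤ B)
    (hle : ∫⁻ ω, ENNReal.ofReal (G ω) ∂P ≤ ENNReal.ofReal B) :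
    Integrable F P ∧ ∫ ω, F ω ∂P ≤ B := by
  rw [integrable_congr hFG, integral_congr_ae hFG]
  refine ⟨⟨hG.aestronglyMeasurable, ?_⟩, ?_⟩
  · rw [hasFiniteIntegral_iff_ofReal (Eventually.of_forall hG0)]
    exact hle.trans_lt ENNReal.ofReal_lt_top
  · rw [integral_eq_lintegral_of_nonneg_ae (Eventually.of_forall hG0) hG.aestronglyMeasurable]
    exact ENNReal.toReal_le_of_le_ofReal hB hle

section Energy

variable (hf : Continuous f) (hfn : f =O[⊤] fun z => (1 + ‖z‖) ^ n)
  (he : ∀ k, MemLp (e k) ((n + 1 : ℕ) : ℝ≥0∞) (cubeMeasure d)) (hlam : ∀ k, 0 ≤ lam k)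
  {C₁ : ℝ} (hC₁ : ∀ z, 0 ≤ primitive f z + C₁) {h₀ : ℝ} (hadm : StepSizeAdmissible e lam f h₀)
  (hN : 1 ≤ N) (hh : 0 < h) (hle : h ≤ h₀)

include hf hfn he hlam hC₁ hadm hN hh hle

lemma exists_continuous_avfGradient_step :
    ∃ step : EuclideanSpace ℝ (Fin N) × EuclideanSpace ℝ (Fin N) →
        EuclideanSpace ℝ (Fin N) × EuclideanSpace ℝ (Fin N),
      Continuous step ∧
        ∀ p q, DiscreteGradientStep (avfGradient e lam f N) h p q ↔ step p = q :=
  exists_continuous_discreteGradientStep (isDiscreteGradient_avfGradient hf hfn he)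
    (potential_nonneg hf hfn he hlam hC₁) (continuous_potential hf hfn he)
    (continuous_avfGradient hf hfn he) hh.le (hadm.existsUnique_avfGradient_step hN hh hle)

lemma IsFullDiscretization.exists_coords (hW : IsWienerProcess S P W)
    (hdisc : IsFullDiscretization e lam f u₀ v₀ P W N M h u v vbar) :
    ∃ X : ℕ → Ω → EuclideanSpace ℝ (Fin N) × EuclideanSpace ℝ (Fin N),
      (∀ m, AEMeasurable (X m) P) ∧
        ∀ᵐ ω ∂P, ∀ m ≤ M, u m ω = embed e N (X m ω).1 ∧ v m ω = embed e N (X m ω).2 := by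
  obtain ⟨step, hcont, hstep⟩ :=
    exists_continuous_avfGradient_step hf hfn he hlam hC₁ hadm hN hh hle
  exact ⟨_, aemeasurable_trajectory hcont (hW.aemeasurable_increment hh.le (coords e N)) _,
    ae_all_iff.2 fun m => ae_all_iff.2 fun hm =>
      (hdisc.ae_eq_trajectory hstep hm).mono fun _ hω => Prod.ext_iff.1 hω⟩

theorem IsFullDiscretization.integral_exp_energy_le [IsProbabilityMeasure P]
    (hW : IsWienerProcess S P W) (hdisc : IsFullDiscretization e lam f u₀ v₀ P W N M h u v vbar)
    (hS : S.IsPositive) (hSQ : S ∘L S = Q) (hHS : Summable fun k => ‖S (e k)‖ ^ 2) {α : ℝ}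
    (hα : opTrace e Q ≤ α) {m : ℕ} (hm : m ≤ M) :
    Integrable (fun ω => exp (energy e lam f C₁ (u m ω) (v m ω) * exp (-α * (m * h)))) P ∧
      ∫ ω, exp (energy e lam f C₁ (u m ω) (v m ω) * exp (-α * (m * h))) ∂P ≤
        exp (energy e lam f C₁ (galerkinProj e N u₀) (galerkinProj e N v₀) +
          ∫ s in (0 : ℝ)..(m * h), 1 / 2 * opTrace e Q * exp (-α * s)) := by
  have hUc : Continuous (potential e lam f C₁ N) := continuous_potential hf hfn he
  obtain ⟨step, hcont, hstep⟩ :=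
    exists_continuous_avfGradient_step hf hfn he hlam hC₁ hadm hN hh hle
  have hincr := hW.aemeasurable_increment hh.le (coords e N)
  have hmoment := lintegral_exp_energy_trajectory_le hcont hUc.measurable
    (potential_nonneg hf hfn he hlam hC₁)
    (fun p => ((hstep p _).2 rfl).energy_eq (isDiscreteGradient_avfGradient hf hfn he)) hh.le
    (opTrace_nonneg hS hSQ) hα (hW.iIndepFun_increments hh.le (coords e N)) hincr
    (hW.hasSubgaussianSqMGF_increment hh (coords e N) fun b K =>
      (sum_norm_coords_sq_le hS hHS b K).trans_eq (opTrace_eq_tsum hS hSQ).symm)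
    (coords e N u₀, coords e N v₀) m
  have hFc : Continuous fun p : EuclideanSpace ℝ (Fin N) × EuclideanSpace ℝ (Fin N) =>
      exp ((potential e lam f C₁ N p.1 + 1 / 2 * ‖p.2‖ ^ 2) * exp (-α * (m * h))) := by fun_prop
  rw [galerkinProj_coe, galerkinProj_coe, energy_embed]
  refine integrable_and_integral_le_of_lintegral_le ?_
    (hFc.measurable.comp_aemeasurable (aemeasurable_trajectory hcont hincr _ m))
    (fun ω => (exp_pos _).le) (exp_pos _).le hmoment
  filter_upwards [hdisc.ae_eq_trajectory hstep hm] with ω hω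
  obtain ⟨hu, hv⟩ := Prod.ext_iff.1 hω
  simp only at hu hv
  rw [hu, hv, Prod.map_fst, Prod.map_snd, energy_embed, Function.comp_apply]

end Energy

end Discretization

section EnergyBounds

lemma le_mul_add_of_pow_three_le {y A G C δ : ℝ} (hA : 0 ≤ A) (hG : 0 ≤ G) (hC : 0 ≤ C)
    (hδ : 0 < δ) (h : y ^ 3 ≤ C * A * G ^ 2) : y ≤ δ * G + C / (3 * δ ^ 2) * A := by
  set D := C / (3 * δ ^ 2) with hD
  have : 0 ≤ D := by positivity
  have hCD : C = 3 * δ ^ 2 * D := by rw [hD]; field_simp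
  have hsum : 0 ≤ δ * G + D * A := by positivity
  refine le_of_pow_le_pow_left₀ three_ne_zero hsum (h.trans ?_)
  have hcube : 0 ≤ (δ * G) ^ 3 + 3 * (δ * G * (D * A) ^ 2) + (D * A) ^ 3 := by positivity
  rw [hCD]
  linear_combination hcube

lemma exists_integral_comp_le_of_growth {X F : Type*} [MeasurableSpace X] {μ : Measure X}
    [IsProbabilityMeasure μ] [NormedAddCommGroup F] {n : ℕ} {q : F → ℝ}
    (hq : q =O[⊤] fun z => (1 + ‖z‖) ^ n) :
    ∃ A : ℝ, 0 ≤ A ∧ ∀ φ : X → F, MemLp φ n μ →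
      ∫ y, q (φ y) ∂μ ≤ A * (1 + ∫ y, ‖φ y‖ ^ n ∂μ) := by
  obtain ⟨C, hC, hbound⟩ := exists_nonneg_growth_bound hq
  refine ⟨C * 2 ^ (n - 1), by positivity, fun φ hφ => ?_⟩
  have hpow : Integrable (fun y => ‖φ y‖ ^ n) μ := hφ.integrable_norm_pow'
  have hpoint (y : X) : ‖q (φ y)‖ ≤ C * 2 ^ (n - 1) * (1 + ‖φ y‖ ^ n) := by
    refine (hbound _).trans ?_
    rw [mul_assoc]
    gcongr
    simpa only [one_pow] using add_pow_le zero_le_one (norm_nonneg (φ y)) n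
  calc ∫ y, q (φ y) ∂μ ≤ ‖∫ y, q (φ y) ∂μ‖ := le_norm_self _
    _ ≤ ∫ y, C * 2 ^ (n - 1) * (1 + ‖φ y‖ ^ n) ∂μ :=
        norm_integral_le_of_norm_le (((integrable_const 1).add hpow).const_mul _)
          (Eventually.of_forall hpoint)
    _ = C * 2 ^ (n - 1) * (1 + ∫ y, ‖φ y‖ ^ n ∂μ) := by
        rw [integral_const_mul, integral_add (integrable_const 1) hpow, integral_const,
          probReal_univ, one_smul]

variable {d n : ℕ} {e : HilbertBasis ℕ ℝ (L2 d)} {lam : ℕ → ℝ} {f : ℝ → ℝ}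

lemma normL6_pow_six {w : L2 d} (hw : MemLp w 6 (cubeMeasure d)) :
    normL6 w ^ 6 = ∫ y, ‖w y‖ ^ 6 ∂cubeMeasure d := by
  have hint : 0 ≤ ∫ y, ‖w y‖ ^ 6 ∂cubeMeasure d := integral_nonneg fun y => by positivity
  rw [normL6, hw.eLpNorm_eq_integral_rpow_norm (by norm_num) (by norm_num)]
  simp only [ENNReal.toReal_ofNat, Real.rpow_ofNat]
  rw [ENNReal.toReal_ofReal (by positivity), ← Real.rpow_ofNat, Real.rpow_inv_rpow hint (by simp)]

lemma mul_sq_norm_le_integral_primitive (hf : Continuous f)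
    (hfn : f =O[⊤] fun z => (1 + ‖z‖) ^ n)
    (he : ∀ k, MemLp (e k) ((n + 1 : ℕ) : ℝ≥0∞) (cubeMeasure d)) {K B : ℝ}
    (hB : ∀ z, K * z ^ 2 ≤ primitive f z + B) {N : ℕ} (x : EuclideanSpace ℝ (Fin N)) :
    K * ‖x‖ ^ 2 ≤ (∫ y, primitive f (evalAt e N y x) ∂cubeMeasure d) + B := by
  have hint := integrable_primitive_evalAt hf hfn he x
  calc K * ‖x‖ ^ 2 = ∫ y, K * evalAt e N y x ^ 2 ∂cubeMeasure d := by
        rw [integral_const_mul, integral_evalAt_sq]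
    _ ≤ ∫ y, (primitive f (evalAt e N y x) + B) ∂cubeMeasure d :=
        integral_mono ((integrable_evalAt_sq x).const_mul K) (hint.add (integrable_const B))
          fun y => hB _
    _ = _ := by
        rw [integral_add hint (integrable_const B), integral_const, probReal_univ, one_smul]

section SixthPower

variable (he : IsDirichletEigenbasis e lam) (hd : d = 1 ∨ d = 2)
  (hfn : f =O[⊤] fun z => (1 + ‖z‖) ^ 5)

include he hd hfn

lemma IsDirichletEigenbasis.exists_normL6_sq_le_energy (hf : Continuous f)
    (hcoer : ∀ K : ℝ, ∃ C, ∀ z, K * z ^ 2 ≤ primitive f z + C) (C₁ : ℝ) {ε : ℝ} (hε : 0 < ε) :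
    ∃ D : ℝ, ∀ (N : ℕ) (x v : EuclideanSpace ℝ (Fin N)),
      normL6 (embed e N x) ^ 2 ≤ ε * energy e lam f C₁ (embed e N x) (embed e N v) + D := by
  obtain ⟨C, hC⟩ := he.exists_normL6_pow_six_le hd
  set A : ℝ := C / (3 * (ε / 2) ^ 2)
  obtain ⟨B, hB⟩ := hcoer (A / ε)
  refine ⟨ε * (B - C₁), fun N x v => ?_⟩
  have hinterp : normL6 (embed e N x) ^ 2 ≤
      ε / 2 * inner ℝ (stiffness N lam x) x + A * ‖x‖ ^ 2 := by
    refine le_mul_add_of_pow_three_le (by positivity) (inner_stiffness_self_nonneg he.lam_nonneg x)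
      C.2 (by positivity) ?_
    rw [← pow_mul]
    exact hC N x
  have hmass : A * ‖x‖ ^ 2 ≤ ε * ((∫ y, primitive f (evalAt e N y x) ∂cubeMeasure d) + B) := by
    have hbound := mul_sq_norm_le_integral_primitive hf hfn
      (fun k => by exact_mod_cast he.memLp_six hd k) hB x
    rw [div_mul_eq_mul_div, div_le_iff₀ hε] at hbound
    rwa [mul_comm ε]
  have hkinetic : 0 ≤ ε * (1 / 2 * ‖v‖ ^ 2) := by positivity
  rw [energy_embed, potential]
  linarith

lemma IsDirichletEigenbasis.exists_energy_galerkinProj_le (C₁ : ℝ) {u₀ : L2 d} (v₀ : L2 d)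
    (hu₀ : MemHdotOne e lam u₀) :
    ∃ B : ℝ, ∀ N, energy e lam f C₁ (galerkinProj e N u₀) (galerkinProj e N v₀) ≤ B := by
  obtain ⟨C, hC⟩ := he.exists_normL6_pow_six_le hd
  obtain ⟨A, hA0, hA⟩ :=
    exists_integral_comp_le_of_growth (μ := cubeMeasure d) (primitive_isBigO hfn)
  refine ⟨1 / 2 * hdotOneNormSq e lam u₀ + 1 / 2 * ‖v₀‖ ^ 2 +
    A * (1 + C * ‖u₀‖ ^ 2 * hdotOneNormSq e lam u₀ ^ 2) + C₁, fun N => ?_⟩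
  have hmem := he.memLp_six_embed hd (coords e N u₀)
  have hstiff := inner_stiffness_coords_le (N := N) he.lam_nonneg hu₀
  have hstiff0 := inner_stiffness_self_nonneg he.lam_nonneg (coords e N u₀)
  have hsix : normL6 (embed e N (coords e N u₀)) ^ 6 ≤
      C * ‖u₀‖ ^ 2 * hdotOneNormSq e lam u₀ ^ 2 := by
    refine (hC N _).trans ?_
    gcongr
    exact norm_coords_le u₀
  have hprim : ∫ y, primitive f (embed e N (coords e N u₀) y) ∂cubeMeasure d ≤
      A * (1 + C * ‖u₀‖ ^ 2 * hdotOneNormSq e lam u₀ ^ 2) := by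
    refine (hA _ (by exact_mod_cast hmem)).trans ?_
    rw [← normL6_pow_six hmem]
    gcongr
  rw [galerkinProj_coe, galerkinProj_coe, energy, hdotOneNormSq_embed, LinearIsometry.norm_map]
  gcongr
  exact norm_coords_le v₀

end SixthPower

end EnergyBounds

section ExponentialMoments

variable {Ω : Type*} [MeasurableSpace Ω] {P : Measure Ω}

lemma exp_sum_le_inv_card_mul_sum_exp {ι : Type*} {s : Finset ι} (hs : s.Nonempty) (a : ι → ℝ) :
    exp (∑ i ∈ s, a i) ≤ (s.card : ℝ)⁻¹ * ∑ i ∈ s, exp (s.card * a i) := by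
  have hcard : (s.card : ℝ) ≠ 0 := Nat.cast_ne_zero.2 hs.card_ne_zero
  have hjensen := convexOn_exp.map_sum_le (t := s) (w := fun _ => (s.card : ℝ)⁻¹)
    (p := fun i => s.card * a i) (fun _ _ => by positivity) (by simp [hcard])
    fun _ _ => Set.mem_univ _
  simpa only [smul_eq_mul, inv_mul_cancel_left₀ hcard, ← Finset.mul_sum] using hjensen

lemma integrable_and_integral_exp_sum_le {ι : Type*} {s : Finset ι} (hs : s.Nonempty)
    {a : ι → Ω → ℝ} (ha : ∀ i ∈ s, AEMeasurable (a i) P) {K : ℝ}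
    (hK : ∀ i ∈ s, Integrable (fun ω => exp (s.card * a i ω)) P ∧
      ∫ ω, exp (s.card * a i ω) ∂P ≤ K) :
    Integrable (fun ω => exp (∑ i ∈ s, a i ω)) P ∧ ∫ ω, exp (∑ i ∈ s, a i ω) ∂P ≤ K := by
  have hdom : Integrable (fun ω => (s.card : ℝ)⁻¹ * ∑ i ∈ s, exp (s.card * a i ω)) P :=
    (integrable_finsetSum s fun i hi => (hK i hi).1).const_mul _
  have hint : Integrable (fun ω => exp (∑ i ∈ s, a i ω)) P := by
    refine hdom.mono' (measurable_exp.comp_aemeasurable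
      (Finset.aemeasurable_fun_sum s ha)).aestronglyMeasurable (Eventually.of_forall fun ω => ?_)
    rw [Real.norm_of_nonneg (exp_pos _).le]
    exact exp_sum_le_inv_card_mul_sum_exp hs fun i => a i ω
  refine ⟨hint, ?_⟩
  calc ∫ ω, exp (∑ i ∈ s, a i ω) ∂P
      ≤ ∫ ω, (s.card : ℝ)⁻¹ * ∑ i ∈ s, exp (s.card * a i ω) ∂P :=
        integral_mono hint hdom fun ω => exp_sum_le_inv_card_mul_sum_exp hs fun i => a i ω
    _ = (s.card : ℝ)⁻¹ * ∑ i ∈ s, ∫ ω, exp (s.card * a i ω) ∂P := by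
        rw [integral_const_mul, integral_finsetSum s fun i hi => (hK i hi).1]
    _ ≤ (s.card : ℝ)⁻¹ * ∑ _i ∈ s, K := by
        gcongr with i hi
        exact (hK i hi).2
    _ = K := by
        rw [Finset.sum_const, nsmul_eq_mul,
          inv_mul_cancel_left₀ (Nat.cast_ne_zero.2 hs.card_ne_zero)]

lemma integral_mul_exp_neg_le {τ t T : ℝ} (hτ : 0 ≤ τ) (ht : 0 ≤ t) (htT : t ≤ T) :
    ∫ s in (0 : ℝ)..t, 1 / 2 * τ * exp (-τ * s) ≤ 1 / 2 * τ * T := by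
  calc ∫ s in (0 : ℝ)..t, 1 / 2 * τ * exp (-τ * s)
      ≤ ∫ _s in (0 : ℝ)..t, 1 / 2 * τ := by
        refine intervalIntegral.integral_mono_on ht
          (Continuous.intervalIntegrable (by fun_prop) _ _) (by simp) fun s hs => ?_
        refine mul_le_of_le_one_right (by positivity) (exp_le_one_iff.2 ?_)
        exact mul_nonpos_of_nonpos_of_nonneg (neg_nonpos.2 hτ) hs.1
    _ = 1 / 2 * τ * t := by rw [intervalIntegral.integral_const, sub_zero, smul_eq_mul, mul_comm]
    _ ≤ 1 / 2 * τ * T := by gcongr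

lemma pos_of_natCast_mul_eq {M : ℕ} {h T : ℝ} (hT : 0 < T) (hMh : M * h = T) : 0 < h :=
  pos_of_mul_pos_right (hMh ▸ hT) M.cast_nonneg

lemma succ_mul_mul_sq_le {y V c D T τ h : ℝ} {i m M : ℕ} (hV : 0 ≤ V) (hc : 0 < c) (hτ : 0 ≤ τ)
    (hT : 0 < T) (hMh : M * h = T) (him : i ≤ m) (hm : m ≤ M)
    (hy : y ^ 2 ≤ exp (-τ * T) / (2 * T * c) * V + D) :
    ((m + 1 : ℕ) : ℝ) * (c * h * y ^ 2) ≤ V * exp (-τ * (i * h)) + 2 * T * c * D := by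
  have hh : 0 < h := pos_of_natCast_mul_eq hT hMh
  have hM : M ≠ 0 := by
    rintro rfl
    simp [hT.ne] at hMh
  have hih : (i : ℝ) * h ≤ T := hMh ▸ by gcongr; exact him.trans hm
  have hcount : ((m + 1 : ℕ) : ℝ) * h ≤ 2 * T := by
    have hle : ((m + 1 : ℕ) : ℝ) ≤ 2 * M := by exact_mod_cast (by lia : m + 1 ≤ 2 * M)
    calc ((m + 1 : ℕ) : ℝ) * h ≤ 2 * M * h := by gcongr
      _ = 2 * T := by rw [mul_assoc, hMh]
  calc ((m + 1 : ℕ) : ℝ) * (c * h * y ^ 2) = (m + 1 : ℕ) * h * (c * y ^ 2) := by ring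
    _ ≤ 2 * T * (c * (exp (-τ * T) / (2 * T * c) * V + D)) := by gcongr
    _ = V * exp (-τ * T) + 2 * T * c * D := by field_simp
    _ ≤ V * exp (-τ * (i * h)) + 2 * T * c * D := by
        have hexp : -τ * T ≤ -τ * (i * h) := mul_le_mul_of_nonpos_left hih (neg_nonpos.2 hτ)
        gcongr

variable {d N M : ℕ} {e : HilbertBasis ℕ ℝ (L2 d)} {lam : ℕ → ℝ} {f : ℝ → ℝ} {u₀ v₀ : L2 d}
  {Q S : L2 d →L[ℝ] L2 d} {W : ℝ≥0 → Ω → L2 d} {h h₀ C₁ c T B D : ℝ} {u v vbar : ℕ → Ω → L2 d}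
  {m : ℕ}

variable (he : IsDirichletEigenbasis e lam) (hd : d = 1 ∨ d = 2) (hf : Continuous f)
  (hfn : f =O[⊤] fun z => (1 + ‖z‖) ^ 5) (hC₁ : ∀ z, 0 ≤ primitive f z + C₁)
  (hadm : StepSizeAdmissible e lam f h₀) (hN : 1 ≤ N) (hle : h ≤ h₀)
  (hW : IsWienerProcess S P W) (hdisc : IsFullDiscretization e lam f u₀ v₀ P W N M h u v vbar)

include he hd hf hfn hC₁ hadm hN hle hW hdisc

lemma IsFullDiscretization.memLp_six_and_aemeasurable_normL6 (hh : 0 < h) :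
    (∀ᵐ ω ∂P, ∀ i ≤ M, MemLp (u i ω) 6 (cubeMeasure d)) ∧
      ∀ i ≤ M, AEMeasurable (fun ω => normL6 (u i ω)) P := by
  obtain ⟨X, hX, hae⟩ := IsFullDiscretization.exists_coords hf hfn
    (fun k => by exact_mod_cast he.memLp_six hd k) he.lam_nonneg hC₁ hadm hN hh hle hW hdisc
  refine ⟨?_, fun i hi => ?_⟩
  · filter_upwards [hae] with ω hω i hi
    rw [(hω i hi).1]
    exact he.memLp_six_embed hd _
  · refine ((continuous_normL6_embed (he.memLp_six_embed hd)).measurable.comp_aemeasurable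
      (hX i).fst).congr ?_
    filter_upwards [hae] with ω hω
    rw [(hω i hi).1, Function.comp_apply]

lemma IsFullDiscretization.ae_succ_mul_mul_normL6_sq_le {τ : ℝ} (hτ : 0 ≤ τ) (hc : 0 < c)
    (hT : 0 < T) (hMh : M * h = T)
    (hD : ∀ x v : EuclideanSpace ℝ (Fin N), normL6 (embed e N x) ^ 2 ≤
      exp (-τ * T) / (2 * T * c) * energy e lam f C₁ (embed e N x) (embed e N v) + D)
    (hm : m ≤ M) :
    ∀ᵐ ω ∂P, ∀ i ≤ m, ((m + 1 : ℕ) : ℝ) * (c * h * normL6 (u i ω) ^ 2) ≤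
      energy e lam f C₁ (u i ω) (v i ω) * exp (-τ * (i * h)) + 2 * T * c * D := by
  have hL (k : ℕ) : MemLp (e k) ((5 + 1 : ℕ) : ℝ≥0∞) (cubeMeasure d) :=
    by exact_mod_cast he.memLp_six hd k
  obtain ⟨X, -, hae⟩ := IsFullDiscretization.exists_coords hf hfn hL he.lam_nonneg hC₁ hadm hN
    (pos_of_natCast_mul_eq hT hMh) hle hW hdisc
  filter_upwards [hae] with ω hω i hi
  rw [(hω i (hi.trans hm)).1, (hω i (hi.trans hm)).2]
  refine succ_mul_mul_sq_le ?_ hc hτ hT hMh hi hm (hD _ _)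
  rw [energy_embed]
  have := potential_nonneg hf hfn hL he.lam_nonneg hC₁ (X i ω).1
  positivity

variable (hS : S.IsPositive) (hSQ : S ∘L S = Q) (hHS : Summable fun k => ‖S (e k)‖ ^ 2)
  (hc : 0 < c) (hT : 0 < T) (hMh : M * h = T)
  (hD : ∀ x v : EuclideanSpace ℝ (Fin N), normL6 (embed e N x) ^ 2 ≤
    exp (-opTrace e Q * T) / (2 * T * c) * energy e lam f C₁ (embed e N x) (embed e N v) + D)
  (hB : energy e lam f C₁ (galerkinProj e N u₀) (galerkinProj e N v₀) ≤ B) (hm : m ≤ M)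

include hS hSQ hHS hc hT hMh hD hB hm

lemma IsFullDiscretization.integral_exp_succ_mul_mul_normL6_sq_le [IsProbabilityMeasure P] {i : ℕ}
    (hi : i ≤ m) :
    Integrable (fun ω => exp ((m + 1 : ℕ) * (c * h * normL6 (u i ω) ^ 2))) P ∧
      ∫ ω, exp ((m + 1 : ℕ) * (c * h * normL6 (u i ω) ^ 2)) ∂P ≤
        exp (B + 1 / 2 * opTrace e Q * T + 2 * T * c * D) := by
  have hh : 0 < h := pos_of_natCast_mul_eq hT hMh
  have hτ : 0 ≤ opTrace e Q := opTrace_nonneg hS hSQ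
  have hiT : (i : ℝ) * h ≤ T := hMh ▸ by gcongr; exact hi.trans hm
  obtain ⟨hint, hmoment⟩ := IsFullDiscretization.integral_exp_energy_le hf hfn
    (fun k => by exact_mod_cast he.memLp_six hd k) he.lam_nonneg hC₁ hadm hN hh hle hW hdisc hS
    hSQ hHS le_rfl (hi.trans hm)
  have hmeas := (IsFullDiscretization.memLp_six_and_aemeasurable_normL6 he hd hf hfn hC₁ hadm hN
    hle hW hdisc hh).2 i (hi.trans hm)
  have hpoint : ∀ᵐ ω ∂P, exp ((m + 1 : ℕ) * (c * h * normL6 (u i ω) ^ 2)) ≤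
      exp (energy e lam f C₁ (u i ω) (v i ω) * exp (-opTrace e Q * (i * h))) *
        exp (2 * T * c * D) := by
    filter_upwards [IsFullDiscretization.ae_succ_mul_mul_normL6_sq_le he hd hf hfn hC₁ hadm hN
      hle hW hdisc hτ hc hT hMh hD hm] with ω hω
    rw [← exp_add]
    exact exp_le_exp.2 (hω i hi)
  have hexp : Integrable (fun ω => exp ((m + 1 : ℕ) * (c * h * normL6 (u i ω) ^ 2))) P := by
    refine (hint.mul_const (exp (2 * T * c * D))).mono' (measurable_exp.comp_aemeasurable
      (((hmeas.pow_const 2).const_mul _).const_mul _)).aestronglyMeasurable ?_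
    filter_upwards [hpoint] with ω hω
    rwa [Real.norm_of_nonneg (exp_pos _).le]
  refine ⟨hexp, (integral_mono_ae hexp (hint.mul_const _) hpoint).trans ?_⟩
  rw [integral_mul_const, exp_add _ (2 * T * c * D)]
  gcongr
  refine hmoment.trans ?_
  gcongr
  exact integral_mul_exp_neg_le hτ (by positivity) hiT

theorem IsFullDiscretization.integral_exp_sum_normL6_sq_le [IsProbabilityMeasure P] :
    (∀ᵐ ω ∂P, ∀ i ≤ m, MemLp (u i ω) 6 (cubeMeasure d)) ∧
      Integrable (fun ω => exp (c * h * ∑ i ∈ Finset.range (m + 1), normL6 (u i ω) ^ 2)) P ∧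
      ∫ ω, exp (c * h * ∑ i ∈ Finset.range (m + 1), normL6 (u i ω) ^ 2) ∂P ≤
        exp (B + 1 / 2 * opTrace e Q * T + 2 * T * c * D) := by
  obtain ⟨hmem, hmeas⟩ := IsFullDiscretization.memLp_six_and_aemeasurable_normL6 he hd hf hfn hC₁
    hadm hN hle hW hdisc (pos_of_natCast_mul_eq hT hMh)
  refine ⟨hmem.mono fun ω hω i hi => hω i (hi.trans hm), ?_⟩
  simp only [Finset.mul_sum]
  have hindex {i : ℕ} (hi : i ∈ Finset.range (m + 1)) : i ≤ m := Finset.mem_range_succ_iff.1 hi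
  refine integrable_and_integral_exp_sum_le Finset.nonempty_range_add_one
    (fun i hi => ((hmeas i ((hindex hi).trans hm)).pow_const 2).const_mul _) fun i hi => ?_
  rw [Finset.card_range]
  exact IsFullDiscretization.integral_exp_succ_mul_mul_normL6_sq_le he hd hf hfn hC₁ hadm hN hle
    hW hdisc hS hSQ hHS hc hT hMh hD hB hm (hindex hi)

end ExponentialMoments

section Cubic

variable {c₀ c₁ c₂ c₃ : ℝ}

lemma continuous_cubic : Continuous (cubic c₀ c₁ c₂ c₃) := by
  unfold cubic
  fun_prop

lemma pow_isBigO_one_add_norm_pow {k n : ℕ} (hkn : k ≤ n) :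
    (fun z : ℝ => z ^ k) =O[⊤] fun z => (1 + ‖z‖) ^ n := by
  refine Asymptotics.isBigO_top.2 ⟨1, fun z => ?_⟩
  have hone : 1 ≤ 1 + ‖z‖ := le_add_of_nonneg_right (norm_nonneg z)
  rw [one_mul, norm_pow, Real.norm_of_nonneg (by positivity : 0 ≤ (1 + ‖z‖) ^ n)]
  calc ‖z‖ ^ k ≤ (1 + ‖z‖) ^ k := by gcongr; exact le_add_of_nonneg_left zero_le_one
    _ ≤ (1 + ‖z‖) ^ n := pow_le_pow_right₀ hone hkn

lemma cubic_isBigO {n : ℕ} (hn : 3 ≤ n) :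
    cubic c₀ c₁ c₂ c₃ =O[⊤] fun z => (1 + ‖z‖) ^ n := by
  have hterm (c : ℝ) {k : ℕ} (hk : k ≤ 3) :
      (fun z => c * z ^ k) =O[⊤] fun z => (1 + ‖z‖) ^ n :=
    (pow_isBigO_one_add_norm_pow (hk.trans hn)).const_mul_left c
  have hsum := ((hterm c₃ le_rfl).add (hterm c₂ (k := 2) (by norm_num))).add
    (hterm c₁ (k := 1) (by norm_num)) |>.add (hterm c₀ (k := 0) (by norm_num))
  simp only [pow_one, pow_zero, mul_one] at hsum
  exact hsum

lemma neg_mul_sq_sub_le_cubic_sub_mul_sub (hc₃ : 0 < c₃) (a b : ℝ) :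
    -((c₂ ^ 2 / (3 * c₃) + |c₁|) * (b - a) ^ 2) ≤
      (cubic c₀ c₁ c₂ c₃ b - cubic c₀ c₁ c₂ c₃ a) * (b - a) := by
  have hslope : 0 ≤ 3 * c₃ / 4 * (a + b + 2 * c₂ / (3 * c₃)) ^ 2 + c₃ / 4 * (b - a) ^ 2 +
      (|c₁| + c₁) := by
    have := neg_abs_le c₁
    have : 0 ≤ |c₁| + c₁ := by linarith
    positivity
  have hfactor : (cubic c₀ c₁ c₂ c₃ b - cubic c₀ c₁ c₂ c₃ a) * (b - a) +
      (c₂ ^ 2 / (3 * c₃) + |c₁|) * (b - a) ^ 2 =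
        (3 * c₃ / 4 * (a + b + 2 * c₂ / (3 * c₃)) ^ 2 + c₃ / 4 * (b - a) ^ 2 + (|c₁| + c₁)) *
          (b - a) ^ 2 := by
    rw [cubic, cubic]
    field_simp
    ring
  have := mul_nonneg hslope (sq_nonneg (b - a))
  linarith

lemma primitive_cubic (z : ℝ) : primitive (cubic c₀ c₁ c₂ c₃) z =
    c₃ / 4 * z ^ 4 + c₂ / 3 * z ^ 3 + c₁ / 2 * z ^ 2 + c₀ * z := by
  have hderiv (y : ℝ) : HasDerivAt
      (fun z => c₃ / 4 * z ^ 4 + c₂ / 3 * z ^ 3 + c₁ / 2 * z ^ 2 + c₀ * z)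
      (cubic c₀ c₁ c₂ c₃ y) y := by
    refine (((((hasDerivAt_pow 4 y).const_mul (c₃ / 4)).add
      ((hasDerivAt_pow 3 y).const_mul (c₂ / 3))).add
      ((hasDerivAt_pow 2 y).const_mul (c₁ / 2))).add
      ((hasDerivAt_id y).const_mul c₀)).congr_deriv ?_
    norm_num [cubic]
    ring
  rw [primitive, intervalIntegral.integral_eq_sub_of_hasDerivAt (fun y _ => hderiv y)
    (continuous_cubic.intervalIntegrable 0 z)]
  ring

lemma exists_quartic_add_nonneg {a : ℝ} (ha : 0 < a) (b c d : ℝ) :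
    ∃ C, ∀ z, 0 ≤ a * z ^ 4 + b * z ^ 3 + c * z ^ 2 + d * z + C := by
  set q := (c - b ^ 2 / (2 * a) - 1) / a with hq
  refine ⟨a / 2 * q ^ 2 + d ^ 2 / 4, fun z => ?_⟩
  have hsquares : a * z ^ 4 + b * z ^ 3 + c * z ^ 2 + d * z + (a / 2 * q ^ 2 + d ^ 2 / 4) =
      a / 2 * (z ^ 2 + b / a * z) ^ 2 + a / 2 * (z ^ 2 + q) ^ 2 + (z + d / 2) ^ 2 := by
    rw [hq]
    field_simp
    ring
  rw [hsquares]
  positivity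

lemma exists_mul_sq_le_primitive_cubic (hc₃ : 0 < c₃) (K : ℝ) :
    ∃ C, ∀ z, K * z ^ 2 ≤ primitive (cubic c₀ c₁ c₂ c₃) z + C := by
  obtain ⟨C, hC⟩ := exists_quartic_add_nonneg (div_pos hc₃ four_pos) (c₂ / 3) (c₁ / 2 - K) c₀
  refine ⟨C, fun z => ?_⟩
  rw [primitive_cubic]
  linarith [hC z]

end Cubic

theorem mainTheorem4_general (d : ℕ) (hd : d = 1 ∨ d = 2)
    (e : HilbertBasis ℕ ℝ (L2 d)) (lam : ℕ → ℝ) (he : IsDirichletEigenbasis e lam)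
    (f : ℝ → ℝ) (hf : Continuous f) (hfn : f =O[⊤] fun z => (1 + ‖z‖) ^ 5)
    (K : ℝ≥0) (hK : ∀ a b, -(K * (b - a) ^ 2) ≤ (f b - f a) * (b - a))
    (hcoer : ∀ κ : ℝ, ∃ C, ∀ z, κ * z ^ 2 ≤ primitive f z + C) :
    (∃ h₀ : ℝ, 0 < h₀ ∧ StepSizeAdmissible e lam f h₀) ∧
    ∀ (u₀ v₀ : L2 d), MemHdotOne e lam u₀ →
    ∀ (Q S : L2 d →L[ℝ] L2 d), S.IsPositive → S ∘L S = Q →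
      (Summable fun k => ‖S (e k)‖ ^ 2) →
    ∀ T : ℝ, 0 < T →
      (∀ c : ℝ, 0 < c → ∃ C : ℝ, 0 < C ∧
        ∀ h₀ : ℝ, StepSizeAdmissible e lam f h₀ →
        ∀ (Ω : Type*) [MeasurableSpace Ω] (P : Measure Ω) [IsProbabilityMeasure P]
          (W : ℝ≥0 → Ω → L2 d), IsWienerProcess S P W →
        ∀ (N M : ℕ), 1 ≤ N → ∀ h : ℝ, M * h = T → h ≤ h₀ →
        ∀ u v vbar : ℕ → Ω → L2 d,
          IsFullDiscretization e lam f u₀ v₀ P W N M h u v vbar →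
        ∀ m ≤ M,
          (∀ᵐ ω ∂P, ∀ i ≤ m, MemLp (u i ω) 6 (cubeMeasure d)) ∧
          Integrable (fun ω => exp (c * h * ∑ i ∈ Finset.range (m + 1), normL6 (u i ω) ^ 2)) P ∧
          ∫ ω, exp (c * h * ∑ i ∈ Finset.range (m + 1), normL6 (u i ω) ^ 2) ∂P ≤ C) ∧
      (∀ C₁ : ℝ, (∀ z : ℝ, 0 ≤ primitive f z + C₁) →
        ∀ α : ℝ, opTrace e Q ≤ α →
        ∀ h₀ : ℝ, StepSizeAdmissible e lam f h₀ →
        ∀ (Ω : Type*) [MeasurableSpace Ω] (P : Measure Ω) [IsProbabilityMeasure P]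
          (W : ℝ≥0 → Ω → L2 d), IsWienerProcess S P W →
        ∀ (N M : ℕ), 1 ≤ N → ∀ h : ℝ, M * h = T → h ≤ h₀ →
        ∀ u v vbar : ℕ → Ω → L2 d,
          IsFullDiscretization e lam f u₀ v₀ P W N M h u v vbar →
        ∀ m ≤ M,
          Integrable (fun ω => exp (energy e lam f C₁ (u m ω) (v m ω) * exp (-α * (m * h)))) P ∧
          ∫ ω, exp (energy e lam f C₁ (u m ω) (v m ω) * exp (-α * (m * h))) ∂P ≤
            exp (energy e lam f C₁ (galerkinProj e N u₀) (galerkinProj e N v₀) +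
              ∫ s in (0 : ℝ)..(m * h), 1 / 2 * opTrace e Q * exp (-α * s))) := by
  have hL (k : ℕ) : MemLp (e k) ((5 + 1 : ℕ) : ℝ≥0∞) (cubeMeasure d) :=
    by exact_mod_cast he.memLp_six hd k
  refine ⟨⟨1 / (1 + K), by positivity, stepSizeAdmissible_of_sq_mul_lt hf hfn hL K.coe_nonneg hK
    he.lam_nonneg ?_⟩, fun u₀ v₀ hu₀ Q S hS hSQ hHS T hT => ⟨fun c hc => ?_, ?_⟩⟩
  · rw [div_pow, one_pow, one_div_mul_eq_div, div_lt_one (by positivity)]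
    nlinarith [K.coe_nonneg]
  · obtain ⟨C₁, hC₁⟩ := hcoer 0
    simp only [zero_mul] at hC₁
    obtain ⟨D, hD⟩ := he.exists_normL6_sq_le_energy hd hfn hf hcoer C₁
      (show 0 < exp (-opTrace e Q * T) / (2 * T * c) by positivity)
    obtain ⟨B, hB⟩ := he.exists_energy_galerkinProj_le hd hfn C₁ v₀ hu₀
    refine ⟨exp (B + 1 / 2 * opTrace e Q * T + 2 * T * c * D), exp_pos _, ?_⟩
    intro h₀ hadm Ω _ P _ W hW N M hN h hMh hle u v vbar hdisc m hm
    exact IsFullDiscretization.integral_exp_sum_normL6_sq_le he hd hf hfn hC₁ hadm hN hle hW hdisc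
      hS hSQ hHS hc hT hMh (hD N) (hB N) hm
  · intro C₁ hC₁ α hα h₀ hadm Ω _ P _ W hW N M hN h hMh hle u v vbar hdisc m hm
    exact IsFullDiscretization.integral_exp_energy_le hf hfn hL he.lam_nonneg hC₁ hadm hN
      (pos_of_natCast_mul_eq hT hMh) hle hW hdisc hS hSQ hHS hα hm

end StochWave

open StochWave in
theorem mainTheorem4 (d : ℕ) (hd : d = 1 ∨ d = 2)
    (e : HilbertBasis ℕ ℝ (L2 d)) (lam : ℕ → ℝ) (he : IsDirichletEigenbasis e lam)
    (c₀ c₁ c₂ c₃ : ℝ) (hc₃ : 0 < c₃) :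
    (∃ h₀ : ℝ, 0 < h₀ ∧ StepSizeAdmissible e lam (cubic c₀ c₁ c₂ c₃) h₀) ∧
    ∀ (u₀ v₀ : L2 d), MemHdotOne e lam u₀ →
    ∀ (Q S : L2 d →L[ℝ] L2 d), Q.IsPositive → S.IsPositive → S ∘L S = Q →
      (Summable fun k => ‖S (e k)‖ ^ 2) →
    ∀ T : ℝ, 0 < T →
      -- the exponential moments of the `L⁶` norms
      (∀ c : ℝ, 0 < c → ∃ C : ℝ, 0 < C ∧
        ∀ h₀ : ℝ, StepSizeAdmissible e lam (cubic c₀ c₁ c₂ c₃) h₀ →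
        ∀ (Ω : Type*) [MeasurableSpace Ω] (P : Measure Ω) [IsProbabilityMeasure P]
          (W : ℝ≥0 → Ω → L2 d), IsWienerProcess S P W →
        ∀ (N M : ℕ), 1 ≤ N → 1 ≤ M → ∀ h : ℝ, M * h = T → h ≤ h₀ →
        ∀ u v vbar : ℕ → Ω → L2 d,
          IsFullDiscretization e lam (cubic c₀ c₁ c₂ c₃) u₀ v₀ P W N M h u v vbar →
        ∀ m ≤ M,
          (∀ᵐ ω ∂P, ∀ i ≤ m, MemLp (u i ω) 6 (cubeMeasure d)) ∧
          Integrable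
            (fun ω => Real.exp (c * h * ∑ i ∈ Finset.range (m + 1), normL6 (u i ω) ^ 2)) P ∧
          ∫ ω, Real.exp (c * h * ∑ i ∈ Finset.range (m + 1), normL6 (u i ω) ^ 2) ∂P ≤ C) ∧
      -- the exponential moments of the energy
      (∀ C₁ : ℝ, (∀ z : ℝ, 0 ≤ primitive (cubic c₀ c₁ c₂ c₃) z + C₁) →
        ∀ α : ℝ, opTrace e Q ≤ α →
        ∀ h₀ : ℝ, StepSizeAdmissible e lam (cubic c₀ c₁ c₂ c₃) h₀ →
        ∀ (Ω : Type*) [MeasurableSpace Ω] (P : Measure Ω) [IsProbabilityMeasure P]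
          (W : ℝ≥0 → Ω → L2 d), IsWienerProcess S P W →
        ∀ (N M : ℕ), 1 ≤ N → 1 ≤ M → ∀ h : ℝ, M * h = T → h ≤ h₀ →
        ∀ u v vbar : ℕ → Ω → L2 d,
          IsFullDiscretization e lam (cubic c₀ c₁ c₂ c₃) u₀ v₀ P W N M h u v vbar →
        ∀ m ≤ M,
          Integrable
            (fun ω => Real.exp (energy e lam (cubic c₀ c₁ c₂ c₃) C₁ (u m ω) (v m ω)
              * Real.exp (-α * (m * h)))) P ∧
          ∫ ω, Real.exp (energy e lam (cubic c₀ c₁ c₂ c₃) C₁ (u m ω) (v m ω)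
              * Real.exp (-α * (m * h))) ∂P
            ≤ Real.exp (energy e lam (cubic c₀ c₁ c₂ c₃) C₁
                  (galerkinProj e N u₀) (galerkinProj e N v₀)
                + ∫ s in (0 : ℝ)..(m * h), 1 / 2 * opTrace e Q * Real.exp (-α * s))) := by
  have hK : 0 ≤ c₂ ^ 2 / (3 * c₃) + |c₁| := by positivity
  obtain ⟨hsolv, hmoments⟩ := mainTheorem4_general d hd e lam he (cubic c₀ c₁ c₂ c₃)
    continuous_cubic (cubic_isBigO (by norm_num)) ⟨_, hK⟩
    (neg_mul_sq_sub_le_cubic_sub_mul_sub hc₃) (exists_mul_sq_le_primitive_cubic hc₃)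
  refine ⟨hsolv, fun u₀ v₀ hu₀ Q S _ hS hSQ hHS T hT => ?_⟩
  obtain ⟨hsix, henergy⟩ := hmoments u₀ v₀ hu₀ Q S hS hSQ hHS T hT
  refine ⟨fun c hc => ?_, fun C₁ hC₁ α hα h₀ hadm Ω _ P _ W hW N M hN _ =>
    henergy C₁ hC₁ α hα h₀ hadm Ω P W hW N M hN⟩
  obtain ⟨C, hC, hle⟩ := hsix c hc
  exact ⟨C, hC, fun h₀ hadm Ω _ P _ W hW N M hN _ => hle h₀ hadm Ω P W hW N M hN⟩
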